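/- \textbf{Spectral Wasserstein rate for reversible Markov shifts.} Let $E$ be a finite set with at least two points, let $P$ be an irreducible aperiodic transition matrix on $E$, let $\pi$ be its stationary law, and assume that $P$ is reversible on $L^2(\pi)$, i.e. $\pi_iP_{ij}=\pi_jP_{ji}$. Put \[ \theta=\max\{|\alpha|:\alpha\in\operatorname{Spec}(P),\ \alpha\neq1\}. \] Let $\mu_P$ be the stationary one-sided Markov measure on $X=E^{\mathbb N_0}$ (the law of the chain with transition matrix $P$ and initial law $\pi$) and let $T$ be the left shift. Fix $0<\beta<1$ and $\eta>0$ such that $\tau:=\eta\beta/(1-\beta)<1$, and put \[ d_{\beta,\eta}(x,x')=\mathbf 1_{\{x_0\ne x_0'\}}+\eta\sum_{r\ge1}\beta^r\mathbf 1_{\{x_r\ne x_r'\}},\qquad B_m(x_1,x_2)=\frac1m\sum_{t=0}^{m-1}\mathbf 1_{\{x_{1,t}\ne x_{2,t}\}} . \] Let $\lambda_\Delta=(x\mapsto(x,x))_\#\mu_P$. Let $Q_m^\Delta$ and $Q_m^\otimes$ be the laws of $(B_m(x_1,x_2),B_m(y_1,y_2))$ when $(x_1,y_1),(x_2,y_2)$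 are independent with law $\lambda_\Delta$, respectively $\mu_P\otimes\mu_P$. For a measure $\lambda$ on $X\times X$, let $\Phi_{2,m}(\lambda)$ be the law, under $\lambda^{\otimes2}$, of the full two-particle array \[ \Bigl(\bigl(d_{\beta,\eta}(T^ax_i,T^bx_j)\bigr),\ \bigl(d_{\beta,\eta}(T^ay_i,T^by_j)\bigr)\Bigr)_{1\le i,j\le2,\ 0\le a,b<m}. \] Let $W_1$ be the $1$-Wasserstein distance for the Euclidean metric on $\mathbb R^2$, respectively the coordinate Euclidean metric on the space of arrays. Put $h(i,j)=\mathbf 1_{\{i\neq j\}}$, $v_h=\operatorname{Var}_{\pi\otimes\pi}(h)$ and \[ \sigma_h^2=v_h+2\sum_{t=1}^\infty\operatorname{Cov}\bigl(h(Z_0),h(Z_t)\bigr), \] where $(Z_t)$ is the stationary Markov chain on $E\times E$ with transition matrix $P\otimes P$ and initial law $\pi\otimes\pi$; let $\sigma_h\ge0$ be the square root of $\sigma_h^2$. Then $d_{\beta,\eta}$ is a metric inducing the product topology, $\mu_P$ is a $T$-invariant probability measure, $\lambda_\Delta$ is a self-joining of $(X,d_{\beta,\eta},\mu_P,T)$,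 the maximum $\theta$ is attained and $\theta<1$, and the following hold. \begin{enumerate} \item The series defining $\sigma_h^2$ converges absolutely and $\sigma_h^2>0$. \item For every $m\ge1$, \[ W_1(Q_m^\Delta,Q_m^\otimes)\le\left(\frac{2v_h(1+\theta)}{m(1-\theta)}\right)^{1/2}. \] \item \[ \liminf_{m\to\infty}\sqrt m\,W_1(Q_m^\Delta,Q_m^\otimes)\ge\frac{\sqrt2\,\sigma_h}{\sqrt\pi}; \] in particular $W_1(Q_m^\Delta,Q_m^\otimes)\ge\sigma_h/\sqrt{2\pi m}$ for all sufficiently large $m$ (in this item and in item 5, the $\pi$ in the constants is the number $3.14159\ldots$). Consequently $W_1(Q_m^\Delta,Q_m^\otimes)$ is of exact order $m^{-1/2}$. \item For every $m\ge1$ there is a map $F$ from the space of arrays to $\mathbb R^2$, Lipschitz with constant $\frac1{(1-\tau)\sqrt m}$, such that $Q_m^\Delta=F_\#\Phi_{2,m}(\lambda_\Delta)$ and $Q_m^\otimes=F_\#\Phi_{2,m}(\mu_P\otimes\mu_P)$, and \[ W_1(Q_m^\Delta,Q_m^\otimes)\le\frac1{(1-\tau)\sqrt m}\,W_1\bigl(\Phi_{2,m}(\lambda_\Delta),\Phi_{2,m}(\mu_P\otimes\mu_P)\bigr).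 \] \item The full raw array laws stay separated: \[ \liminf_{m\to\infty}W_1\bigl(\Phi_{2,m}(\lambda_\Delta),\Phi_{2,m}(\mu_P\otimes\mu_P)\bigr)\ge\frac{\sqrt2\,(1-\tau)\,\sigma_h}{\sqrt\pi}. \] \end{enumerate} -/

import Mathlib

open MeasureTheory ProbabilityTheory Filter Topology
open scoped ENNReal NNReal Kronecker

noncomputable section

/-! ### Wasserstein distance, joinings, distance arrays -/

/-- The `1`-Wasserstein distance: the infimum of the transport costs `∫ d(a, b) dγ(a, b)` over all
couplings `γ` of `μ` and `ν`. -/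
def wasserstein1 {X : Type*} [PseudoEMetricSpace X] [MeasurableSpace X] (μ ν : Measure X) :
    ℝ≥0∞ :=
  ⨅ γ ∈ {γ : Measure (X × X) | γ.map Prod.fst = μ ∧ γ.map Prod.snd = ν},
    ∫⁻ z, edist z.1 z.2 ∂γ

/-- `l` is a joining of the measure-preserving systems `(X, μ, T)` and `(Y, ν, S)`. -/
def IsJoining {X Y : Type*} [MeasurableSpace X] [MeasurableSpace Y] (μ : Measure X) (T : X → X)
    (ν : Measure Y) (S : Y → Y) (l : Measure (X × Y)) : Prop :=
  l.map Prod.fst = μ ∧ l.map Prod.snd = ν ∧ l.map (Prod.map T S) = l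

/-- The graph joining `(x ↦ (x, x))_# μ`. -/
def diagJoining {X : Type*} [MeasurableSpace X] (μ : Measure X) : Measure (X × X) :=
  μ.map (fun x => (x, x))

/-- Positions `((i, a), (j, b))` in an orbit-distance matrix of `n` particles observed at the times
`0 ≤ a, b < m`. -/
abbrev ArrayIndex (n m : ℕ) : Type := (Fin n × Fin m) × (Fin n × Fin m)

/-- Pairs of orbit-distance matrices, with the coordinate Euclidean metric. -/
abbrev ArraySpace (n m : ℕ) : Type := EuclideanSpace ℝ (ArrayIndex n m ⊕ ArrayIndex n m)

/-- The pair of matrices `(d_X (T^a x_i, T^b x_j))` and `(d_Y (S^a y_i, S^b y_j))` of the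
particles `z_i = (x_i, y_i)`. -/
def distanceArray {X Y : Type*} (dX : X → X → ℝ) (T : X → X) (dY : Y → Y → ℝ) (S : Y → Y)
    (n m : ℕ) (z : Fin n → X × Y) : ArraySpace n m :=
  WithLp.toLp 2 (Sum.elim
    (fun p : ArrayIndex n m =>
      dX (T^[(p.1.2 : ℕ)] (z p.1.1).1) (T^[(p.2.2 : ℕ)] (z p.2.1).1))
    (fun p : ArrayIndex n m =>
      dY (S^[(p.1.2 : ℕ)] (z p.1.1).2) (S^[(p.2.2 : ℕ)] (z p.2.1).2)))

/-- The unanchored distance-array projection `Φ_{n,m}(l)`: the law of the distance arrays of `n`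
independent particles with law `l`. -/
def arrayLaw {X Y : Type*} [MeasurableSpace X] [MeasurableSpace Y]
    (dX : X → X → ℝ) (T : X → X) (dY : Y → Y → ℝ) (S : Y → Y) (n m : ℕ)
    (l : Measure (X × Y)) : Measure (ArraySpace n m) :=
  (Measure.pi (fun _ : Fin n => l)).map (distanceArray dX T dY S n m)

/-! ### Finite Markov chains -/

section Weights

variable {E : Type*} [Fintype E]

/-- The measure with weights `w` on a finite set. -/
def weightMeasure [MeasurableSpace E] (w : E → ℝ) : Measure E :=
  ∑ i, ENNReal.ofReal (w i) • Measure.dirac i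

theorem isProbabilityMeasure_weightMeasure [MeasurableSpace E] (w : E → ℝ) (h0 : ∀ i, 0 ≤ w i)
    (h1 : ∑ i, w i = 1) : IsProbabilityMeasure (weightMeasure w) := by
  constructor
  simp only [weightMeasure, Measure.coe_finsetSum, Finset.sum_apply, Measure.smul_apply,
    measure_univ, smul_eq_mul, mul_one]
  rw [← ENNReal.ofReal_sum_of_nonneg (fun i _ => h0 i), h1, ENNReal.ofReal_one]

/-- The law `π ⊗ π`. -/
def pairLaw (π : stdSimplex ℝ E) : stdSimplex ℝ (E × E) :=
  ⟨fun z => π.1 z.1 * π.1 z.2, fun z => mul_nonneg (π.2.1 _) (π.2.1 _), by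
    simp only [Fintype.sum_prod_type, ← Finset.mul_sum, π.2.2, mul_one]⟩

end Weights

section Chain

variable {E : Type*} [Fintype E] [DecidableEq E]

/-- Aperiodicity: for every state `i`, the possible return times to `i` have greatest common
divisor `1`. -/
def IsAperiodic (P : Matrix E E ℝ) : Prop :=
  ∀ i, Nat.setGcd {n : ℕ | 0 < n ∧ 0 < (P ^ n) i i} = 1

/-- `π` is stationary for `P`. -/
def IsStationaryLaw (P : Matrix E E ℝ) (π : E → ℝ) : Prop :=
  Matrix.vecMul π P = π

/-- Reversibility (detailed balance): `P` is symmetric for the inner product of `L²(π)`. -/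
def IsReversibleFor (P : Matrix E E ℝ) (π : E → ℝ) : Prop :=
  ∀ i j, π i * P i j = π j * P j i

/-- The moduli of the eigenvalues of `P` other than `1`. A reversible `P` is self-adjoint on `L²(π)`,
so its spectrum is real. -/
def nontrivialSpectralModuli (P : Matrix E E ℝ) : Set ℝ :=
  {r | ∃ α ∈ spectrum ℝ P, α ≠ 1 ∧ r = |α|}

/-- `θ`, the largest modulus of an eigenvalue of `P` other than `1`. -/
def spectralTheta (P : Matrix E E ℝ) : ℝ := sSup (nontrivialSpectralModuli P)

/-- A transition matrix as a Markov kernel. -/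
def transitionKernel [MeasurableSpace E] [DiscreteMeasurableSpace E]
    (P : Matrix.rowStochastic ℝ E) : Kernel E E where
  toFun i := weightMeasure (P.1 i)
  measurable' := Measurable.of_discrete

instance instIsMarkovKernelTransitionKernel [MeasurableSpace E] [DiscreteMeasurableSpace E]
    (P : Matrix.rowStochastic ℝ E) : IsMarkovKernel (transitionKernel P) :=
  ⟨fun i => isProbabilityMeasure_weightMeasure _ (fun j => P.2.1 i j)
    (Matrix.sum_row_of_mem_rowStochastic P.2 i)⟩

/-- The law on `E^ℕ` of the Markov chain with transition matrix `P` and initial law `π`. -/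
def markovMeasure [MeasurableSpace E] [DiscreteMeasurableSpace E]
    (P : Matrix.rowStochastic ℝ E) (π : stdSimplex ℝ E) : Measure (ℕ → E) :=
  Kernel.trajMeasure (X := fun _ => E) (weightMeasure π.1)
    (fun n => (transitionKernel P).comap
      (fun x : (i : Finset.Iic n) → E => x ⟨n, Finset.mem_Iic.2 le_rfl⟩)
      (measurable_pi_apply _))

/-- The transition matrix `P ⊗ P` of two independent copies of a chain. -/
def pairTransition (P : Matrix.rowStochastic ℝ E) : Matrix.rowStochastic ℝ (E × E) :=
  ⟨P.1 ⊗ₖ P.1, by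
    rw [Matrix.mem_rowStochastic_iff_sum]
    refine ⟨fun i j => mul_nonneg (P.2.1 _ _) (P.2.1 _ _), fun i => ?_⟩
    simp only [Matrix.kroneckerMap_apply, Fintype.sum_prod_type, ← Finset.mul_sum,
      Matrix.sum_row_of_mem_rowStochastic P.2, mul_one]⟩

end Chain

/-! ### The Markov shift and the two-particle mismatch observable -/

section Shift

variable {E : Type*} [DecidableEq E]

/-- The left shift. -/
def leftShift (x : ℕ → E) : ℕ → E := fun t => x (t + 1)

/-- The mismatch function `h(i, j) = 1_{i ≠ j}`. -/
def mismatch (z : E × E) : ℝ := if z.1 ≠ z.2 then 1 else 0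

/-- `d_{β,η}(x, x') = 1_{x_0 ≠ x'_0} + η ∑_{r ≥ 1} β^r 1_{x_r ≠ x'_r}`. -/
def pathDist (β η : ℝ) (x x' : ℕ → E) : ℝ :=
  mismatch (x 0, x' 0) + η * ∑' r : ℕ, β ^ (r + 1) * mismatch (x (r + 1), x' (r + 1))

/-- `d` is a metric that induces the product topology of `E^ℕ`, where `E` is discrete. -/
def IsCompatiblePathMetric (d : (ℕ → E) → (ℕ → E) → ℝ) : Prop :=
  ∃ M : MetricSpace (ℕ → E), (∀ x x', M.toDist.dist x x' = d x x') ∧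
    M.toUniformSpace.toTopologicalSpace =
      @Pi.topologicalSpace ℕ (fun _ => E) (fun _ => ⊥)

/-- The mismatch average `B_m(x_1, x_2)`. -/
def mismatchAverage (m : ℕ) (x₁ x₂ : ℕ → E) : ℝ :=
  (1 / (m : ℝ)) * ∑ t ∈ Finset.range m, mismatch (x₁ t, x₂ t)

/-- The law of `(B_m(x_1, x_2), B_m(y_1, y_2))` for two independent particles `(x_i, y_i)` with
law `l`. -/
def mismatchLaw [MeasurableSpace E] (m : ℕ) (l : Measure ((ℕ → E) × (ℕ → E))) :
    Measure (EuclideanSpace ℝ (Fin 2)) :=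
  (Measure.pi (fun _ : Fin 2 => l)).map
    (fun z => !₂[mismatchAverage m (z 0).1 (z 1).1, mismatchAverage m (z 0).2 (z 1).2])

variable [Fintype E] [MeasurableSpace E] [DiscreteMeasurableSpace E]

/-- `v_h = Var_{π ⊗ π}(h)`. -/
def mismatchVariance (π : stdSimplex ℝ E) : ℝ :=
  Var[mismatch; (weightMeasure π.1).prod (weightMeasure π.1)]

/-- `Cov(h(Z_0), h(Z_t))` for the chain `Z` on `E × E` with transition `P ⊗ P` started from
`π ⊗ π`. -/
def mismatchCov (P : Matrix.rowStochastic ℝ E) (π : stdSimplex ℝ E) (t : ℕ) : ℝ :=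
  cov[fun z => mismatch (z 0), fun z => mismatch (z t);
    markovMeasure (pairTransition P) (pairLaw π)]

/-- `σ_h² = v_h + 2 ∑_{t ≥ 1} Cov(h(Z_0), h(Z_t))`. -/
def mismatchSigmaSq (P : Matrix.rowStochastic ℝ E) (π : stdSimplex ℝ E) : ℝ :=
  mismatchVariance π + 2 * ∑' t : ℕ, mismatchCov P π (t + 1)

end Shift

end

/-! ### Finite Markov operators with a spectral gap -/

/-! Let `ρ` be the law of `B_m(x₁, x₂)` for independent stationary paths. Under the diagonal joining
the two mismatch averages coincide, so the plane law is that of `(b, b)` with `b ∼ ρ`. Under the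
product joining they are independent, so it is that of `(b, b')`. Sharing the first coordinate gives
a coupling of cost `E|b - b'|`. In any coupling the first point lies on the diagonal, whose distance
from `(b, b')` is `|b - b'| / √2`. Hence `E|b - b'| / √2 ≤ W₁ ≤ E|b - b'|`
(`lintegral_le_wasserstein1`, `wasserstein1_le`), and everything reduces to the fluctuations of an
additive functional of the chain `P ⊗ P`.

Reversibility gives an eigenbasis of `L²(π)`. Irreducibility and aperiodicity leave only the
constants at modulus `1`, so `P` contracts mean-zero functions by `θ < 1`
(`ReversibleChain.hasSpectralGap`), and `P ⊗ P` does so with the same `θ`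
(`HasSpectralGap.kronecker`). Summing the covariances `≤ v_h θ^|s-t|` bounds `Var B_m`, and `(E|b -
b'|)² ≤ 2 Var b` gives the upper bound. With `g` the Poisson solution for the centred mismatch,
`σ_h² = ‖g‖² - ‖Kg‖²`, which the gap makes positive.

For the lower bound, a perturbed eigenvector of the twisted operator proves the central limit
theorem at the level of characteristic functions (`tendsto_twist_pow`). Thus `√m (b - b')` converges
to `N(0, 2σ_h²)`, whose mean absolute value is `2σ_h/√π`, and Fatou's lemma for weak convergence
bounds the liminf.

For the arrays, `d_{β,η}` is at most `τ` when the initial letters agree and at least `1` when they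
differ. A ramp from `τ` to `1` therefore recovers the mismatch exactly, and averaging `m` entries
has Lipschitz constant `1/((1-τ)√m)`. This factor cancels the `√m` of the central limit theorem, so
the array laws stay a fixed distance apart. -/

open Matrix in
/-- A Markov matrix `K` with positive stationary weights `w` that contracts the mean-zero functions
of `L²(w)` by the factor `θ < 1`. -/
structure HasSpectralGap {S : Type*} [Fintype S] (K : Matrix S S ℝ) (w : S → ℝ) (θ : ℝ) : Prop where
  pos : ∀ i, 0 < w i
  sum_eq_one : ∑ i, w i = 1
  nonneg : ∀ i j, 0 ≤ K i j
  row_sum : ∀ i, ∑ j, K i j = 1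
  stationary : w ᵥ* K = w
  theta_nonneg : 0 ≤ θ
  theta_lt_one : θ < 1
  contract : ∀ f : S → ℝ, w ⬝ᵥ f = 0 → w ⬝ᵥ (K *ᵥ f) ^ 2 ≤ θ ^ 2 * (w ⬝ᵥ f ^ 2)

namespace HasSpectralGap

open Matrix

variable {S : Type*} [Fintype S] {K : Matrix S S ℝ} {w : S → ℝ} {θ : ℝ}

theorem mean_mulVec (hK : HasSpectralGap K w θ) (f : S → ℝ) : w ⬝ᵥ (K *ᵥ f) = w ⬝ᵥ f := by
  rw [dotProduct_mulVec, hK.stationary]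

theorem mean_sq_nonneg (hK : HasSpectralGap K w θ) (f : S → ℝ) : 0 ≤ w ⬝ᵥ f ^ 2 :=
  Finset.sum_nonneg fun i _ => mul_nonneg (hK.pos i).le (by simp only [Pi.pow_apply]; positivity)

theorem mean_mul_sq_le (hK : HasSpectralGap K w θ) (f g : S → ℝ) :
    (w ⬝ᵥ (f * g)) ^ 2 ≤ (w ⬝ᵥ f ^ 2) * (w ⬝ᵥ g ^ 2) := by
  refine Finset.sum_sq_le_sum_mul_sum_of_sq_le_mul _ ?_ ?_ ?_
  · intro i _; have := (hK.pos i).le; simp only [Pi.pow_apply]; positivity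
  · intro i _; have := (hK.pos i).le; simp only [Pi.pow_apply]; positivity
  · intro i _; simp only [Pi.pow_apply, Pi.mul_apply]; exact le_of_eq (by ring)

/-! ### The Poisson equation and the asymptotic variance -/

section Poisson

variable [DecidableEq S]

theorem mean_pow (hK : HasSpectralGap K w θ) (t : ℕ) (f : S → ℝ) :
    w ⬝ᵥ (K ^ t *ᵥ f) = w ⬝ᵥ f := by
  induction t generalizing f with
  | zero => simp
  | succ t ih => rw [pow_succ, ← mulVec_mulVec, ih, dotProduct_mulVec, hK.stationary]

theorem contract_pow (hK : HasSpectralGap K w θ) (t : ℕ) {f : S → ℝ} (hf : w ⬝ᵥ f = 0) :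
    w ⬝ᵥ (K ^ t *ᵥ f) ^ 2 ≤ (θ ^ t) ^ 2 * (w ⬝ᵥ f ^ 2) := by
  induction t with
  | zero => simp
  | succ t ih =>
    rw [pow_succ' K, ← mulVec_mulVec]
    refine (hK.contract _ (by rw [hK.mean_pow, hf])).trans ?_
    calc θ ^ 2 * (w ⬝ᵥ (K ^ t *ᵥ f) ^ 2) ≤ θ ^ 2 * ((θ ^ t) ^ 2 * (w ⬝ᵥ f ^ 2)) := by gcongr
      _ = _ := by ring

theorem abs_mean_mul_pow_le (hK : HasSpectralGap K w θ) (t : ℕ) {f : S → ℝ} (hf : w ⬝ᵥ f = 0) :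
    |w ⬝ᵥ (f * (K ^ t *ᵥ f))| ≤ θ ^ t * (w ⬝ᵥ f ^ 2) := by
  have hN := hK.mean_sq_nonneg f
  have h0 := hK.theta_nonneg
  refine abs_le_of_sq_le_sq ?_ (by positivity)
  calc _ ≤ _ := hK.mean_mul_sq_le _ _
    _ ≤ (w ⬝ᵥ f ^ 2) * ((θ ^ t) ^ 2 * (w ⬝ᵥ f ^ 2)) := by gcongr; exact hK.contract_pow t hf
    _ = _ := by ring

/-- Since every weight is positive, one coordinate is controlled by the whole `L²(w)` norm, which
decays like `θ ^ t`. -/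
theorem summable_pow_apply (hK : HasSpectralGap K w θ) {f : S → ℝ} (hf : w ⬝ᵥ f = 0) (x : S) :
    Summable fun t : ℕ => (K ^ t *ᵥ f) x := by
  have h0 := hK.theta_nonneg
  have hN := hK.mean_sq_nonneg f
  have hx := hK.pos x
  refine Summable.of_norm_bounded
    ((summable_geometric_of_lt_one h0 hK.theta_lt_one).mul_right (√((w ⬝ᵥ f ^ 2) / w x)))
    fun t => ?_
  rw [Real.norm_eq_abs]
  refine abs_le_of_sq_le_sq ?_ (by positivity)
  rw [mul_pow, Real.sq_sqrt (by positivity), ← mul_div_assoc, le_div_iff₀ hx, mul_comm]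
  refine le_trans ?_ (hK.contract_pow t hf)
  exact Finset.single_le_sum (f := fun i => w i * ((K ^ t *ᵥ f) ^ 2) i)
    (fun i _ => mul_nonneg (hK.pos i).le (by simp only [Pi.pow_apply]; positivity))
    (Finset.mem_univ x)

/-- The solution `∑ Kᵗ f` of the Poisson equation `g - K g = f`. -/
noncomputable def poisson (K : Matrix S S ℝ) (f : S → ℝ) : S → ℝ := fun x => ∑' t : ℕ, (K ^ t *ᵥ f) x

theorem hasSum_mulVec_poisson (hK : HasSpectralGap K w θ) {f : S → ℝ} (hf : w ⬝ᵥ f = 0) (x : S) :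
    HasSum (fun t : ℕ => (K ^ (t + 1) *ᵥ f) x) ((K *ᵥ poisson K f) x) := by
  have : (fun t : ℕ => (K ^ (t + 1) *ᵥ f) x) = fun t => ∑ y, K x y * (K ^ t *ᵥ f) y := by
    funext t; rw [pow_succ', ← mulVec_mulVec]; rfl
  rw [this]
  exact hasSum_sum fun y _ => (hK.summable_pow_apply hf y).hasSum.mul_left _

theorem poisson_eq (hK : HasSpectralGap K w θ) {f : S → ℝ} (hf : w ⬝ᵥ f = 0) :
    poisson K f = f + K *ᵥ poisson K f := by
  funext x
  rw [Pi.add_apply, ← (hK.hasSum_mulVec_poisson hf x).tsum_eq, poisson,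
    (hK.summable_pow_apply hf x).tsum_eq_zero_add]
  simp

theorem mean_poisson (hK : HasSpectralGap K w θ) {f : S → ℝ} (hf : w ⬝ᵥ f = 0) :
    w ⬝ᵥ poisson K f = 0 := by
  have : HasSum (fun t : ℕ => w ⬝ᵥ (K ^ t *ᵥ f)) (w ⬝ᵥ poisson K f) :=
    hasSum_sum fun y _ => (hK.summable_pow_apply hf y).hasSum.mul_left _
  simp only [hK.mean_pow, hf] at this
  exact this.unique hasSum_zero

/-- The asymptotic variance of the additive functional of `f`. -/
noncomputable def asympVar (K : Matrix S S ℝ) (w f : S → ℝ) : ℝ :=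
  w ⬝ᵥ f ^ 2 + 2 * (w ⬝ᵥ (f * (K *ᵥ poisson K f)))

theorem hasSum_cov (hK : HasSpectralGap K w θ) {f : S → ℝ} (hf : w ⬝ᵥ f = 0) :
    HasSum (fun t : ℕ => w ⬝ᵥ (f * (K ^ (t + 1) *ᵥ f))) (w ⬝ᵥ (f * (K *ᵥ poisson K f))) :=
  hasSum_sum fun x _ => ((hK.hasSum_mulVec_poisson hf x).mul_left _).mul_left _

/-- With `f = g - Kg`, the asymptotic variance telescopes to `‖g‖² - ‖Kg‖² ≥ (1 - θ²)‖g‖²`, and `g`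
cannot vanish unless `f` does. -/
theorem asympVar_pos (hK : HasSpectralGap K w θ) {f : S → ℝ} (hf : w ⬝ᵥ f = 0) (hf0 : f ≠ 0) :
    0 < asympVar K w f := by
  set g := poisson K f with hg
  have hp := hK.poisson_eq hf
  rw [← hg] at hp
  have hfg : f = g - K *ᵥ g := by rw [eq_sub_iff_add_eq]; exact hp.symm
  have key : asympVar K w f = w ⬝ᵥ g ^ 2 - w ⬝ᵥ (K *ᵥ g) ^ 2 := by
    rw [asympVar, ← hg]
    conv_lhs => rw [hfg]
    rw [← smul_eq_mul (2 : ℝ), ← dotProduct_smul, ← dotProduct_add, ← dotProduct_sub]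
    congr 1; funext x; simp; ring
  have hg0 : g ≠ 0 := by
    intro h; rw [h] at hfg; apply hf0; rw [hfg]; simp
  have hgpos : 0 < w ⬝ᵥ g ^ 2 := by
    obtain ⟨x, hx⟩ := Function.ne_iff.1 hg0
    have hx' : g x ≠ 0 := hx
    refine Finset.sum_pos' (fun i _ => mul_nonneg (hK.pos i).le ?_) ⟨x, Finset.mem_univ _, ?_⟩
    · simp only [Pi.pow_apply]; positivity
    · have := hK.pos x; simp only [Pi.pow_apply]; positivity
  have hc := hK.contract g (hK.mean_poisson hf)
  have h1 : θ ^ 2 < 1 := by have := hK.theta_nonneg; have := hK.theta_lt_one; nlinarith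
  rw [key]; nlinarith

end Poisson

/-! ### The twisted transition operator and its perturbed leading eigenvector -/

section Twist

/-- The transition matrix twisted by the phase `exp (i ε h)`. -/
noncomputable def twist (K : Matrix S S ℝ) (h : S → ℝ) (ε : ℝ) : Matrix S S ℂ :=
  fun x y => Complex.exp ((ε * h x : ℝ) * Complex.I) * (K x y : ℂ)

theorem norm_twist_mulVec_le (hK : HasSpectralGap K w θ) (h : S → ℝ) (ε : ℝ) (f : S → ℂ) :
    ‖twist K h ε *ᵥ f‖ ≤ ‖f‖ := by
  rw [pi_norm_le_iff_of_nonneg (norm_nonneg _)]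
  intro x
  calc ‖∑ y, twist K h ε x y * f y‖ ≤ ∑ y, K x y * ‖f‖ := by
        refine norm_sum_le_of_le _ fun y _ => ?_
        rw [norm_mul, twist, norm_mul, Complex.norm_exp_ofReal_mul_I, one_mul, Complex.norm_real,
          Real.norm_of_nonneg (hK.nonneg x y)]
        exact mul_le_mul_of_nonneg_left (norm_le_pi_norm f y) (hK.nonneg x y)
    _ = ‖f‖ := by rw [← Finset.sum_mul, hK.row_sum, one_mul]

variable [DecidableEq S]

theorem norm_twist_pow_mulVec_le (hK : HasSpectralGap K w θ) (h : S → ℝ) (ε : ℝ) (m : ℕ)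
    (f : S → ℂ) : ‖twist K h ε ^ m *ᵥ f‖ ≤ ‖f‖ := by
  induction m with
  | zero => simp
  | succ m ih =>
    rw [pow_succ', ← mulVec_mulVec]
    exact (hK.norm_twist_mulVec_le h ε _).trans ih

/-- The twisted operator and multiplication by `c` are both contractions, so the defect of an
approximate eigenvector enters at most once per iteration. -/
theorem norm_twist_pow_sub_le (hK : HasSpectralGap K w θ) (h : S → ℝ) (ε : ℝ) (m : ℕ)
    (f : S → ℂ) (c : ℂ) (hc : ‖c‖ ≤ 1) :
    ‖twist K h ε ^ m *ᵥ f - c ^ m • f‖ ≤ m * ‖twist K h ε *ᵥ f - c • f‖ := by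
  induction m with
  | zero => simp
  | succ m ih =>
    have : twist K h ε ^ (m + 1) *ᵥ f - c ^ (m + 1) • f =
        twist K h ε *ᵥ (twist K h ε ^ m *ᵥ f - c ^ m • f) +
          c ^ m • (twist K h ε *ᵥ f - c • f) := by
      rw [pow_succ', ← mulVec_mulVec, mulVec_sub, mulVec_smul, smul_sub, smul_smul, ← pow_succ]
      abel
    rw [this]
    refine (norm_add_le _ _).trans ?_
    have h1 := hK.norm_twist_mulVec_le h ε (twist K h ε ^ m *ᵥ f - c ^ m • f)
    have h2 : ‖c ^ m • (twist K h ε *ᵥ f - c • f)‖ ≤ ‖twist K h ε *ᵥ f - c • f‖ := by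
      rw [norm_smul, norm_pow]
      exact mul_le_of_le_one_left (norm_nonneg _) (pow_le_one₀ (norm_nonneg _) hc)
    push_cast
    linarith

/-- The pointwise form of the eigenvector expansion: `A` and `B` stand for `Ka` and `Kb` at one
state. The relations `ha` and `hb` are what matching the terms of order `ε` and `ε²` requires. -/
theorem norm_exp_mul_sub_le {h A B s a b ε : ℝ} (hh : |h| ≤ 1) (hε : |ε| ≤ 1) (ha : a = h + A)
    (hb : b = s / 2 - h * A - h ^ 2 / 2 + B) :
    ‖Complex.exp ((ε * h : ℝ) * Complex.I) * (1 + ε * Complex.I * A + ε ^ 2 * B) -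
        (1 - ε ^ 2 * (s / 2) : ℝ) * (1 + ε * Complex.I * a + ε ^ 2 * b)‖ ≤
      ((1 + |A| + |B|) + |A| + |B| + |B| + |s * a| + |s * b|) * |ε| ^ 3 := by
  set z : ℂ := (ε * h : ℝ) * Complex.I with hz
  have hzn : ‖z‖ ≤ |ε| := by
    rw [hz, norm_mul, Complex.norm_I, mul_one, Complex.norm_real, Real.norm_eq_abs, abs_mul]
    exact mul_le_of_le_one_right (abs_nonneg _) hh
  have hr : ‖Complex.exp z - (1 + z + z ^ 2 / 2)‖ ≤ |ε| ^ 3 := by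
    have h1 := Complex.exp_bound (hzn.trans hε) (n := 3) (by norm_num)
    have h2 : ∑ m ∈ Finset.range 3, z ^ m / (m.factorial : ℂ) = 1 + z + z ^ 2 / 2 := by
      simp [Finset.sum_range_succ]
    rw [h2] at h1
    refine h1.trans ?_
    have h3 : ‖z‖ ^ 3 ≤ |ε| ^ 3 := by gcongr
    have h4 : (0 : ℝ) ≤ ‖z‖ ^ 3 := by positivity
    norm_num [Nat.factorial]
    linarith
  set r := Complex.exp z - (1 + z + z ^ 2 / 2) with hrdef
  have hexp : Complex.exp z = r + (1 + z + z ^ 2 / 2) := by rw [hrdef]; ring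
  have I2 : Complex.I ^ 2 = -1 := Complex.I_sq
  -- All terms of order below three cancel; the remainder consists of the exponential's Taylor error
  -- and explicit terms in `ε³` and `ε⁴`.
  have key : Complex.exp z * (1 + ε * Complex.I * A + ε ^ 2 * B) -
        (1 - ε ^ 2 * (s / 2) : ℝ) * (1 + ε * Complex.I * a + ε ^ 2 * b) =
      r * (1 + ε * Complex.I * A + ε ^ 2 * B)
      + ((ε ^ 3 : ℝ) * (((h * B : ℝ) : ℂ) * Complex.I) + (ε ^ 3 : ℝ) * (((-(h ^ 2 * A) / 2 : ℝ) : ℂ) *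
        Complex.I) + (ε ^ 4 : ℝ) * ((-(h ^ 2 * B) / 2 : ℝ) : ℂ) + (ε ^ 3 : ℝ) * (((s * a / 2 : ℝ) : ℂ) *
        Complex.I) + (ε ^ 4 : ℝ) * ((s * b / 2 : ℝ) : ℂ)) := by
    rw [hexp, hz, ha, hb]
    push_cast
    linear_combination ((ε : ℂ) ^ 2 * h * A + ε ^ 2 * h ^ 2 / 2 + ε ^ 3 * h ^ 2 / 2 * A * Complex.I +
      ε ^ 4 * h ^ 2 / 2 * B) * I2
  have e0 : 0 ≤ |ε| := abs_nonneg ε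
  have e4 : |ε| ^ 4 ≤ |ε| ^ 3 := pow_le_pow_of_le_one e0 hε (by norm_num)
  have hh2 : |h| ^ 2 ≤ 1 := pow_le_one₀ (abs_nonneg _) hh
  have n3 : ∀ (c D : ℝ), |c| ≤ D → ‖((ε ^ 3 : ℝ) : ℂ) * ((c : ℂ) * Complex.I)‖ ≤ D * |ε| ^ 3 := by
    intro c D hc
    rw [norm_mul, norm_mul, Complex.norm_I, mul_one, Complex.norm_real, Complex.norm_real,
      Real.norm_eq_abs, Real.norm_eq_abs, abs_pow, mul_comm]
    gcongr
  have n4 : ∀ (c D : ℝ), |c| ≤ D → ‖((ε ^ 4 : ℝ) : ℂ) * (c : ℂ)‖ ≤ D * |ε| ^ 3 := by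
    intro c D hc
    have := (abs_nonneg c).trans hc
    rw [norm_mul, Complex.norm_real, Complex.norm_real,
      Real.norm_eq_abs, Real.norm_eq_abs, abs_pow, mul_comm]
    gcongr
  have hhalf : ∀ c : ℝ, |c / 2| ≤ |c| := fun c => by
    rw [abs_div, abs_two]; linarith [abs_nonneg c]
  have b1 : ‖(1 + ε * Complex.I * A + ε ^ 2 * B : ℂ)‖ ≤ 1 + |A| + |B| := by
    refine norm_add₃_le.trans ?_
    rw [norm_one, norm_mul, norm_mul, norm_mul, norm_pow, Complex.norm_I, mul_one,
      Complex.norm_real, Complex.norm_real, Complex.norm_real, Real.norm_eq_abs, Real.norm_eq_abs,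
      Real.norm_eq_abs]
    have := mul_le_of_le_one_left (abs_nonneg A) hε
    have := mul_le_of_le_one_left (abs_nonneg B) (pow_le_one₀ e0 hε : |ε| ^ 2 ≤ 1)
    linarith
  have t1 : ‖r * (1 + ε * Complex.I * A + ε ^ 2 * B)‖ ≤ (1 + |A| + |B|) * |ε| ^ 3 := by
    rw [norm_mul, mul_comm]; gcongr
  have t2 := n3 (h * B) |B| (by rw [abs_mul]; exact mul_le_of_le_one_left (abs_nonneg _) hh)
  have hA2 : ∀ c : ℝ, |-(h ^ 2 * c) / 2| ≤ |c| := fun c => by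
    refine (hhalf _).trans ?_
    rw [abs_neg, abs_mul, abs_pow]; exact mul_le_of_le_one_left (abs_nonneg _) hh2
  have t3 := n3 (-(h ^ 2 * A) / 2) |A| (hA2 A)
  have t4 := n4 (-(h ^ 2 * B) / 2) |B| (hA2 B)
  have t5 := n3 (s * a / 2) |s * a| (hhalf _)
  have t6 := n4 (s * b / 2) |s * b| (hhalf _)
  rw [key]
  refine (norm_add_le _ _).trans ?_
  refine (add_le_add t1 ((norm_add_le _ _).trans (add_le_add ((norm_add_le _ _).trans
    (add_le_add ((norm_add_le _ _).trans (add_le_add ((norm_add_le _ _).trans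
    (add_le_add t2 t3)) t4)) t5)) t6))).trans (le_of_eq ?_)
  ring

/-- The vector is `W = 1 + iεa + ε²b`. Order `ε` asks for `a - Ka = f`, and order `ε²` asks for `b -
Kb = s/2 - f·Ka - f²/2`; both are Poisson equations. -/
theorem exists_approx_eigenvector (hK : HasSpectralGap K w θ) {f : S → ℝ} (hf : w ⬝ᵥ f = 0)
    (hf1 : ∀ x, |f x| ≤ 1) : ∃ C : ℝ, 0 ≤ C ∧ ∀ ε : ℝ, |ε| ≤ 1 → ∃ W : S → ℂ,
      ‖W - 1‖ ≤ C * |ε| ∧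
      ‖twist K f ε *ᵥ W - ((1 - ε ^ 2 * (asympVar K w f / 2) : ℝ) : ℂ) • W‖ ≤ C * |ε| ^ 3 := by
  set s := asympVar K w f with hs
  set a := poisson K f with ha
  set c : S → ℝ := fun x => s / 2 - f x * (K *ᵥ a) x - f x ^ 2 / 2 with hc
  set b := poisson K c with hb
  -- Solvability at second order: `s = asympVar K w f` is the value for which this right-hand side
  -- has mean zero.
  have hcm : w ⬝ᵥ c = 0 := by
    have : w ⬝ᵥ c = s / 2 * ∑ i, w i - w ⬝ᵥ (f * (K *ᵥ a)) - (w ⬝ᵥ f ^ 2) / 2 := by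
      simp only [dotProduct, hc, Finset.mul_sum, Finset.sum_div, ← Finset.sum_sub_distrib,
        Pi.mul_apply, Pi.pow_apply]
      exact Finset.sum_congr rfl fun i _ => by ring
    rw [this, hK.sum_eq_one, hs, asympVar]; ring
  have hpa : ∀ x, a x = f x + (K *ᵥ a) x := fun x => congrFun (hK.poisson_eq hf) x
  have hpb : ∀ x, b x = s / 2 - f x * (K *ᵥ a) x - f x ^ 2 / 2 + (K *ᵥ b) x :=
    fun x => congrFun (hK.poisson_eq hcm) x
  -- One constant per state serves both estimates: the bracket is the third-order defect and the
  -- last summand bounds `W - 1`. Summing over states makes it uniform.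
  set D : S → ℝ := fun x => ((1 + |(K *ᵥ a) x| + |(K *ᵥ b) x|) + |(K *ᵥ a) x| + |(K *ᵥ b) x| +
    |(K *ᵥ b) x| + |s * a x| + |s * b x|) + (|a x| + |b x|) with hD
  have hD0 : ∀ x, 0 ≤ D x := fun x => by positivity
  have hDs : ∀ x, D x ≤ ∑ y, D y := fun x =>
    Finset.single_le_sum (fun y _ => hD0 y) (Finset.mem_univ x)
  have hS0 : 0 ≤ ∑ y, D y := Finset.sum_nonneg fun y _ => hD0 y
  refine ⟨∑ x, D x, hS0, fun ε hε =>
    ⟨fun x => 1 + ε * Complex.I * a x + ε ^ 2 * b x, ?_, ?_⟩⟩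
  · rw [pi_norm_le_iff_of_nonneg (by positivity)]
    intro x
    have h1 : ((fun x => 1 + ε * Complex.I * a x + ε ^ 2 * b x : S → ℂ) - 1) x =
        ε * Complex.I * a x + ε ^ 2 * b x := by simp; ring
    rw [h1]
    refine (norm_add_le _ _).trans ?_
    rw [norm_mul, norm_mul, norm_mul, norm_pow, Complex.norm_I, mul_one,
      Complex.norm_real, Complex.norm_real, Complex.norm_real, Real.norm_eq_abs, Real.norm_eq_abs,
      Real.norm_eq_abs]
    have h2 : |ε| ^ 2 ≤ |ε| := pow_le_of_le_one (abs_nonneg _) hε (by norm_num)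
    have h3 : |a x| + |b x| ≤ ∑ y, D y := by
      refine le_trans ?_ (hDs x); simp only [hD]
      exact le_add_of_nonneg_left (by positivity)
    calc |ε| * |a x| + |ε| ^ 2 * |b x| ≤ |ε| * |a x| + |ε| * |b x| := by gcongr
      _ = (|a x| + |b x|) * |ε| := by ring
      _ ≤ _ := by gcongr
  · rw [pi_norm_le_iff_of_nonneg (by positivity)]
    intro x
    have h1 : (twist K f ε *ᵥ (fun x => 1 + ε * Complex.I * a x + ε ^ 2 * b x : S → ℂ)) x =
        Complex.exp ((ε * f x : ℝ) * Complex.I) *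
          (1 + ε * Complex.I * ((K *ᵥ a) x : ℝ) + ε ^ 2 * ((K *ᵥ b) x : ℝ)) := by
      have h2 : (1 : ℂ) = ((∑ y, K x y : ℝ) : ℂ) := by rw [hK.row_sum, Complex.ofReal_one]
      simp only [mulVec, dotProduct, twist]
      conv_rhs => rw [h2]
      push_cast
      simp only [Finset.mul_sum, ← Finset.sum_add_distrib]
      exact Finset.sum_congr rfl fun y _ => by ring
    rw [Pi.sub_apply, Pi.smul_apply, h1, smul_eq_mul]
    refine (norm_exp_mul_sub_le (hf1 x) hε (hpa x) (hpb x)).trans ?_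
    refine mul_le_mul_of_nonneg_right (le_trans ?_ (hDs x)) (by positivity)
    simp only [hD]
    exact le_add_of_nonneg_right (by positivity)

/-- The characteristic functions in the central limit theorem for additive functionals. -/
theorem tendsto_twist_pow (hK : HasSpectralGap K w θ) {f : S → ℝ} (hf : w ⬝ᵥ f = 0)
    (hf1 : ∀ x, |f x| ≤ 1) (ξ : ℝ) :
    Tendsto (fun m : ℕ => ∑ x, (w x : ℂ) * (twist K f (ξ / √m) ^ m *ᵥ 1) x) atTop
      (𝓝 (Complex.exp ((-(ξ ^ 2 * (asympVar K w f / 2)) : ℝ)))) := by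
  obtain ⟨C, hC, hW⟩ := hK.exists_approx_eigenvector hf hf1
  set s := asympVar K w f with hs
  have hlim : Tendsto (fun m : ℕ => (((1 - (ξ / √m) ^ 2 * (s / 2)) ^ m : ℝ) : ℂ)) atTop
      (𝓝 (Complex.exp ((-(ξ ^ 2 * (s / 2)) : ℝ)))) := by
    rw [← Complex.ofReal_exp]
    refine (Complex.continuous_ofReal.tendsto _).comp ?_
    refine (Real.tendsto_one_add_div_pow_exp (-(ξ ^ 2 * (s / 2)))).congr fun m => ?_
    rw [div_pow, Real.sq_sqrt (Nat.cast_nonneg _)]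
    congr 1; ring
  have hε0 : Tendsto (fun m : ℕ => |ξ / √(m : ℝ)|) atTop (𝓝 0) := by
    have h1 : Tendsto (fun m : ℕ => √(m : ℝ)) atTop atTop :=
      Real.tendsto_sqrt_atTop.comp tendsto_natCast_atTop_atTop
    simpa using (tendsto_const_nhds.div_atTop h1 : Tendsto (fun m : ℕ => ξ / √(m : ℝ)) _ _).abs
  have hb : Tendsto (fun m : ℕ => (2 * C + C * ξ ^ 2) * |ξ / √(m : ℝ)|) atTop (𝓝 0) := by
    simpa using hε0.const_mul (2 * C + C * ξ ^ 2)
  -- The approximate eigenvalue has modulus at most `1` once `ε` is small, because `s ≥ 0`.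
  have hlam : ∀ᶠ m : ℕ in atTop, |1 - (ξ / √(m : ℝ)) ^ 2 * (s / 2)| ≤ 1 := by
    have h0 : 0 ≤ s := by
      by_cases h : f = 0
      · rw [hs, asympVar, h]; simp
      · exact (hK.asympVar_pos hf h).le
    have h1 : Tendsto (fun m : ℕ => |ξ / √(m : ℝ)| ^ 2 * (s / 2)) atTop (𝓝 (0 ^ 2 * (s / 2))) :=
      (hε0.pow 2).mul_const _
    rw [zero_pow two_ne_zero, zero_mul] at h1
    filter_upwards [h1.eventually (eventually_le_nhds (zero_lt_one))] with m hm
    rw [sq_abs] at hm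
    have : 0 ≤ (ξ / √(m : ℝ)) ^ 2 * (s / 2) := by positivity
    rw [abs_le]; constructor <;> linarith
  refine tendsto_of_tendsto_of_dist hlim ?_
  refine squeeze_zero' (Eventually.of_forall fun _ => dist_nonneg) ?_ hb
  filter_upwards [hε0.eventually (eventually_le_nhds (zero_lt_one)), hlam, eventually_gt_atTop 0]
    with m hm hl hm0
  set ε := ξ / √(m : ℝ) with hε
  obtain ⟨W, hW1, hW2⟩ := hW ε hm
  set l : ℂ := ((1 - ε ^ 2 * (s / 2) : ℝ) : ℂ) with hldef
  have hln : ‖l‖ ≤ 1 := by rw [hldef, Complex.norm_real, Real.norm_eq_abs]; exact hl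
  have hmain : ‖twist K f ε ^ m *ᵥ (1 : S → ℂ) - l ^ m • 1‖ ≤ 2 * (C * |ε|) + m * (C * |ε| ^ 3) := by
    -- Replacing `1` by `W` costs `O(ε)` twice; the iteration on `W` itself costs `m · O(ε³)`.
    have hdec : twist K f ε ^ m *ᵥ (1 : S → ℂ) - l ^ m • 1 =
        (twist K f ε ^ m *ᵥ W - l ^ m • W) + (l ^ m • (W - 1) - twist K f ε ^ m *ᵥ (W - 1)) := by
      rw [mulVec_sub, smul_sub]; abel
    rw [hdec]
    refine (norm_add_le _ _).trans ?_
    have h1 := hK.norm_twist_pow_sub_le f ε m W l hln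
    have h2 := hK.norm_twist_pow_mulVec_le f ε m (W - 1)
    have h3 : ‖l ^ m • (W - 1)‖ ≤ ‖W - 1‖ := by
      rw [norm_smul, norm_pow]
      exact mul_le_of_le_one_left (norm_nonneg _) (pow_le_one₀ (norm_nonneg _) hln)
    have h4 := norm_sub_le (l ^ m • (W - 1)) (twist K f ε ^ m *ᵥ (W - 1))
    have h5 : (m : ℝ) * ‖twist K f ε *ᵥ W - l • W‖ ≤ m * (C * |ε| ^ 3) := by gcongr
    linarith
  -- This scaling turns the accumulated error `m|ε|³` into `ξ²|ε|`, which tends to zero.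
  have hmε : (m : ℝ) * |ε| ^ 2 = ξ ^ 2 := by
    have : (0 : ℝ) < m := by exact_mod_cast hm0
    rw [sq_abs, hε, div_pow, Real.sq_sqrt this.le]; field_simp
  rw [dist_comm, dist_eq_norm]
  have hsum : ∑ x, (w x : ℂ) * (twist K f ε ^ m *ᵥ 1) x - (((1 - ε ^ 2 * (s / 2)) ^ m : ℝ) : ℂ) =
      ∑ x, (w x : ℂ) * (twist K f ε ^ m *ᵥ (1 : S → ℂ) - l ^ m • 1) x := by
    simp only [Pi.sub_apply, mul_sub, Finset.sum_sub_distrib]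
    congr 1
    have h1 : (∑ x, (w x : ℂ)) = 1 := by
      rw [← Complex.ofReal_sum, hK.sum_eq_one, Complex.ofReal_one]
    simp only [Pi.smul_apply, Pi.one_apply, smul_eq_mul, mul_one]
    rw [← Finset.sum_mul, h1, one_mul, hldef]; push_cast; rfl
  rw [hsum]
  calc ‖∑ x, (w x : ℂ) * (twist K f ε ^ m *ᵥ (1 : S → ℂ) - l ^ m • 1) x‖
      ≤ ∑ x, w x * (2 * (C * |ε|) + m * (C * |ε| ^ 3)) := by
        refine norm_sum_le_of_le _ fun x _ => ?_
        rw [norm_mul, Complex.norm_real, Real.norm_of_nonneg (hK.pos x).le]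
        exact mul_le_mul_of_nonneg_left ((norm_le_pi_norm _ x).trans hmain) (hK.pos x).le
    _ = 2 * (C * |ε|) + C * |ε| * (m * |ε| ^ 2) := by
        rw [← Finset.sum_mul, hK.sum_eq_one]; ring
    _ = _ := by rw [hmε]; ring

end Twist

end HasSpectralGap

/-! ### The spectral gap of a reversible irreducible aperiodic transition matrix -/

namespace ReversibleChain

open Matrix

variable {E : Type*} [Fintype E]

/-- The equality case of the maximum principle: the nonnegative deficits `q y * (M - g y)` sum to
zero. -/
theorem eq_of_average_eq_bound {q g : E → ℝ} {M : ℝ} (hq : ∀ y, 0 ≤ q y) (hq1 : ∑ y, q y = 1)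
    (hg : ∀ y, g y ≤ M) (h : ∑ y, q y * g y = M) {y : E} (hy : 0 < q y) : g y = M := by
  have h1 : ∑ y, q y * (M - g y) = 0 := by
    simp only [mul_sub, Finset.sum_sub_distrib, h, ← Finset.sum_mul, hq1]; ring
  rw [Finset.sum_eq_zero_iff_of_nonneg
    (fun y _ => mul_nonneg (hq y) (sub_nonneg.2 (hg y)))] at h1
  have := h1 y (Finset.mem_univ y)
  rcases mul_eq_zero.1 this with h | h <;> linarith

variable [DecidableEq E]

theorem pow_mulVec_eq {P : Matrix E E ℝ} {f : E → ℝ} {α : ℝ} (h : P *ᵥ f = α • f) (n : ℕ) :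
    P ^ n *ᵥ f = α ^ n • f := by
  induction n with
  | zero => simp
  | succ n ih => rw [pow_succ, ← mulVec_mulVec, h, mulVec_smul, ih, smul_smul, pow_succ']

theorem mem_spectrum_iff_exists {P : Matrix E E ℝ} {α : ℝ} :
    α ∈ spectrum ℝ P ↔ ∃ f : E → ℝ, f ≠ 0 ∧ P *ᵥ f = α • f := by
  rw [← Matrix.spectrum_toLin', ← Module.End.hasEigenvalue_iff_mem_spectrum]
  constructor
  · intro h
    obtain ⟨f, hf⟩ := h.exists_hasEigenvector
    exact ⟨f, hf.2, by simpa using hf.apply_eq_smul⟩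
  · rintro ⟨f, hf0, hf⟩
    refine Module.End.hasEigenvalue_of_hasEigenvector (x := f) ⟨?_, hf0⟩
    rw [Module.End.mem_eigenspace_iff]; simpa using hf

variable (P : Matrix.rowStochastic ℝ E)

theorem pow_nonneg_apply (n : ℕ) (i j : E) : 0 ≤ (P.1 ^ n) i j := (P ^ n).2.1 i j

theorem pow_row_sum (n : ℕ) (i : E) : ∑ j, (P.1 ^ n) i j = 1 :=
  Matrix.sum_row_of_mem_rowStochastic (P ^ n).2 i

variable {P}

/-- Start from a maximum point: irreducibility reaches every state with positive probability in some
number of steps, and equality in the average propagates the maximum there. -/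
theorem harmonic_eq (hirr : P.1.IsIrreducible) {f : E → ℝ} (hf : P.1 *ᵥ f = f) (x y : E) :
    f x = f y := by
  have : Nonempty E := ⟨x⟩
  obtain ⟨z, hz⟩ := Finite.exists_max f
  have key : ∀ y, f y = f z := fun y => by
    obtain ⟨n, -, hn⟩ := (isIrreducible_iff_exists_pow_pos P.2.1).1 hirr z y
    have h1 := congrFun (pow_mulVec_eq (α := 1) (by simpa using hf) n) z
    rw [one_pow, one_smul] at h1
    exact eq_of_average_eq_bound (pow_nonneg_apply P n z) (pow_row_sum P n z) hz h1 hn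
  rw [key x, key y]

theorem abs_eigenvalue_le_one {f : E → ℝ} (hf0 : f ≠ 0) {α : ℝ} (hf : P.1 *ᵥ f = α • f) :
    |α| ≤ 1 := by
  obtain ⟨x0, hx0⟩ := Function.ne_iff.1 hf0
  have : Nonempty E := ⟨x0⟩
  obtain ⟨z, hz⟩ := Finite.exists_max (fun x => |f x|)
  have hzpos : 0 < |f z| := (abs_pos.2 hx0).trans_le (hz x0)
  have h1 : |α| * |f z| ≤ 1 * |f z| := by
    have h2 : ∑ y, P.1 z y * f y = α * f z := congrFun hf z
    rw [← abs_mul, ← h2, ← Matrix.sum_row_of_mem_rowStochastic P.2 z, Finset.sum_mul]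
    refine (Finset.abs_sum_le_sum_abs _ _).trans (Finset.sum_le_sum fun y _ => ?_)
    rw [abs_mul, abs_of_nonneg (P.2.1 z y)]
    exact mul_le_mul_of_nonneg_left (hz y) (P.2.1 z y)
  exact le_of_mul_le_mul_right h1 hzpos

/-- An eigenvector for `-1` would force every return time to a maximum point of `|f|` to be even,
contradicting aperiodicity. -/
theorem neg_one_not_eigenvalue (haper : IsAperiodic P.1) {f : E → ℝ} (hf0 : f ≠ 0) :
    P.1 *ᵥ f ≠ (-1 : ℝ) • f := by
  intro hf
  obtain ⟨x0, hx0⟩ := Function.ne_iff.1 hf0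
  have : Nonempty E := ⟨x0⟩
  obtain ⟨z, hz⟩ := Finite.exists_max (fun x => |f x|)
  have hzpos : 0 < |f z| := (abs_pos.2 hx0).trans_le (hz x0)
  have hsq : 0 < f z ^ 2 := by rw [← sq_abs]; positivity
  have heven : 2 ∣ Nat.setGcd {n : ℕ | 0 < n ∧ 0 < (P.1 ^ n) z z} := by
    rw [Nat.dvd_setGcd_iff]
    rintro n ⟨-, hn⟩
    by_contra hodd
    have hodd : Odd n := Nat.not_even_iff_odd.1 (fun h => hodd h.two_dvd)
    have h1 : ∑ y, (P.1 ^ n) z y * f y = (-1) ^ n * f z := congrFun (pow_mulVec_eq hf n) z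
    rw [hodd.neg_one_pow] at h1
    -- For odd `n` the average of `-f(z)f(y)` attains its upper bound `f(z)²`. A positive return
    -- probability then allows `y = z`, giving `-f(z)² = f(z)²`.
    have h2 : ∑ y, (P.1 ^ n) z y * (-(f z * f y)) = f z ^ 2 := by
      have : ∑ y, (P.1 ^ n) z y * (-(f z * f y)) = -f z * ∑ y, (P.1 ^ n) z y * f y := by
        rw [Finset.mul_sum]; exact Finset.sum_congr rfl fun y _ => by ring
      rw [this, h1]; ring
    have h3 : ∀ y, -(f z * f y) ≤ f z ^ 2 := fun y => by
      refine (neg_le_abs _).trans ?_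
      rw [abs_mul, ← sq_abs (f z), sq]
      exact mul_le_mul_of_nonneg_left (hz y) (abs_nonneg _)
    have h4 := eq_of_average_eq_bound (pow_nonneg_apply P n z) (pow_row_sum P n z) h3 h2 hn
    nlinarith
  rw [haper z] at heven
  omega

theorem stationary_pos (hirr : P.1.IsIrreducible) {w : E → ℝ} (h0 : ∀ i, 0 ≤ w i)
    (h1 : ∑ i, w i = 1) (hstat : IsStationaryLaw P.1 w) (j : E) : 0 < w j := by
  obtain ⟨i, -, hi⟩ : ∃ i ∈ Finset.univ, 0 < w i := by
    by_contra! h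
    have := Finset.sum_nonpos h
    linarith
  obtain ⟨n, -, hn⟩ := (isIrreducible_iff_exists_pow_pos P.2.1).1 hirr i j
  have hs : ∀ n : ℕ, w ᵥ* P.1 ^ n = w := by
    intro n
    induction n with
    | zero => simp
    | succ n ih => rw [pow_succ, ← vecMul_vecMul, ih, hstat]
  rw [← hs n]
  exact Finset.sum_pos' (fun k _ => mul_nonneg (h0 k) (pow_nonneg_apply P n k j))
    ⟨i, Finset.mem_univ i, mul_pos hi hn⟩

/-- The symmetrisation `D^{1/2} P D^{-1/2}` of a reversible matrix. -/
noncomputable def symmetrization (P : Matrix E E ℝ) (w : E → ℝ) : Matrix E E ℝ :=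
  fun x y => √(w x) * P x y / √(w y)

omit [Fintype E] [DecidableEq E] in
theorem symmetrization_isHermitian {P : Matrix E E ℝ} {w : E → ℝ} (hw : ∀ i, 0 < w i)
    (hrev : IsReversibleFor P w) : (symmetrization P w).IsHermitian := by
  ext x y
  have hx := Real.sqrt_pos.2 (hw x)
  have hy := Real.sqrt_pos.2 (hw y)
  have hx2 := Real.sq_sqrt (hw x).le
  have hy2 := Real.sq_sqrt (hw y).le
  have := hrev x y
  rw [Matrix.conjTranspose_apply, symmetrization, symmetrization, star_trivial,
    div_eq_div_iff hx.ne' hy.ne']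
  calc √(w y) * P y x * √(w y) = √(w y) ^ 2 * P y x := by ring
    _ = √(w x) ^ 2 * P x y := by rw [hx2, hy2, this]
    _ = _ := by ring

omit [DecidableEq E] in
theorem symmetrization_mulVec {P : Matrix E E ℝ} {w : E → ℝ} (hw : ∀ i, 0 < w i) (f : E → ℝ)
    (x : E) : (symmetrization P w *ᵥ fun y => √(w y) * f y) x = √(w x) * (P *ᵥ f) x := by
  simp only [mulVec, dotProduct, symmetrization, Finset.mul_sum]
  refine Finset.sum_congr rfl fun y _ => ?_
  have hy := Real.sqrt_pos.2 (hw y)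
  field_simp

theorem finite_nontrivialSpectralModuli : (nontrivialSpectralModuli P.1).Finite := by
  refine (Matrix.finite_real_spectrum (A := P.1)).image (fun α => |α|) |>.subset ?_
  rintro r ⟨α, h, -, rfl⟩
  exact ⟨α, h, rfl⟩

/-! ### Eigenbasis of `L²(w)` and the spectral gap -/

section Spectral

variable {w : E → ℝ} (hw : ∀ i, 0 < w i) (hrev : IsReversibleFor P.1 w)
include hw hrev

/-- Multiplication by `√w` is an isometry from `L²(w)` to Euclidean space and conjugates `P` to its
symmetrization. The orthonormal eigenbasis there is divided by `√w`; the last clause is Parseval's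
identity. -/
theorem exists_eigenbasis : ∃ (u : E → E → ℝ) (l : E → ℝ),
    (∀ i, P.1 *ᵥ u i = l i • u i) ∧
    (∀ i j, ∑ x, w x * (u i x * u j x) = if i = j then 1 else 0) ∧
    (∀ f : E → ℝ, ∑ x, w x * f x ^ 2 = ∑ i, (∑ x, w x * (u i x * f x)) ^ 2) := by
  have hA := symmetrization_isHermitian hw hrev
  set b := hA.eigenvectorBasis with hb
  have hs : ∀ x, 0 < √(w x) := fun x => Real.sqrt_pos.2 (hw x)
  have hs2 : ∀ x, √(w x) * √(w x) = w x := fun x => Real.mul_self_sqrt (hw x).le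
  have hbu : ∀ i, (b i : E → ℝ) = fun x => √(w x) * (b i x / √(w x)) := fun i => by
    funext x; have := hs x; field_simp
  refine ⟨fun i x => b i x / √(w x), hA.eigenvalues, fun i => ?_, fun i j => ?_, fun f => ?_⟩
  · funext x
    have h1 := congrFun (hA.mulVec_eigenvectorBasis i) x
    rw [← hb, hbu i, symmetrization_mulVec hw] at h1
    refine mul_left_cancel₀ (hs x).ne' (h1.trans ?_)
    simp only [Pi.smul_apply, smul_eq_mul]; ring
  · have h1 := orthonormal_iff_ite.1 b.orthonormal i j
    rw [← h1, PiLp.inner_apply]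
    refine Finset.sum_congr rfl fun x _ => ?_
    have h2 := hs2 x
    have h3 := hs x
    simp only [RCLike.inner_apply, conj_trivial]
    generalize √(w x) = s at h2 h3 ⊢
    rw [← h2]; field_simp
  · have h1 := b.sum_sq_norm_inner_right (WithLp.toLp 2 (fun x => √(w x) * f x))
    rw [EuclideanSpace.norm_sq_eq] at h1
    have e1 : ∑ x, w x * f x ^ 2 =
        ∑ x, ‖(WithLp.toLp 2 (fun x => √(w x) * f x) : EuclideanSpace ℝ E) x‖ ^ 2 := by
      refine Finset.sum_congr rfl fun x _ => ?_
      rw [Real.norm_eq_abs, sq_abs, mul_pow, Real.sq_sqrt (hw x).le]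
    rw [e1, ← h1]
    refine Finset.sum_congr rfl fun i _ => ?_
    rw [Real.norm_eq_abs, sq_abs, PiLp.inner_apply]
    congr 1
    refine Finset.sum_congr rfl fun x _ => ?_
    have h2 := hs2 x
    have h3 := hs x
    simp only [RCLike.inner_apply, conj_trivial]
    generalize √(w x) = s at h2 h3 ⊢
    rw [← h2]; field_simp

variable (hw1 : ∑ i, w i = 1) (hirr : P.1.IsIrreducible)
include hirr

include hw1

/-- If all eigenvalues were `1`, all basis vectors would be constant, and two constants cannot be
orthonormal. -/
theorem nonempty_nontrivialSpectralModuli [Nontrivial E] :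
    (nontrivialSpectralModuli P.1).Nonempty := by
  obtain ⟨u, l, hu, ho, -⟩ := exists_eigenbasis hw hrev
  have hu0 : ∀ i, u i ≠ 0 := fun i h => by
    have := ho i i; simp [h] at this
  by_cases hl : ∃ i, l i ≠ 1
  · obtain ⟨i, hi⟩ := hl
    exact ⟨|l i|, l i, mem_spectrum_iff_exists.2 ⟨u i, hu0 i, hu i⟩, hi, rfl⟩
  · exfalso
    push Not at hl
    obtain ⟨i, j, hij⟩ := exists_pair_ne E
    have hc : ∀ i x, u i x = u i j := fun k x =>
      harmonic_eq hirr (by rw [hu k, hl k, one_smul]) x j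
    have e : ∀ k k', ∑ x, w x * (u k x * u k' x) = u k j * u k' j := fun k k' => by
      rw [← one_mul (u k j * u k' j), ← hw1, Finset.sum_mul]
      exact Finset.sum_congr rfl fun x _ => by rw [hc k, hc k']
    have h1 := ho i j; have h2 := ho i i; have h3 := ho j j
    rw [e, if_neg hij] at h1
    rw [e, if_pos rfl] at h2 h3
    rcases mul_eq_zero.1 h1 with h | h
    · rw [h] at h2; norm_num at h2
    · rw [h] at h3; norm_num at h3

theorem isGreatest_spectralTheta [Nontrivial E] :
    IsGreatest (nontrivialSpectralModuli P.1) (spectralTheta P.1) :=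
  ⟨(nonempty_nontrivialSpectralModuli hw hrev hw1 hirr).csSup_mem
    (finite_nontrivialSpectralModuli),
    fun _ hr => le_csSup (finite_nontrivialSpectralModuli).bddAbove hr⟩

theorem spectralTheta_lt_one [Nontrivial E] (haper : IsAperiodic P.1) : spectralTheta P.1 < 1 := by
  obtain ⟨α, hα, h1, hr⟩ := (isGreatest_spectralTheta hw hrev hw1 hirr).1
  obtain ⟨f, hf0, hf⟩ := mem_spectrum_iff_exists.1 hα
  rw [hr]
  refine lt_of_le_of_ne (abs_eigenvalue_le_one hf0 hf) fun h => ?_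
  rcases eq_or_eq_neg_of_abs_eq h with h | h
  · exact h1 h
  · rw [h] at hf; exact neg_one_not_eigenvalue haper hf0 hf

theorem hasSpectralGap [Nontrivial E] (haper : IsAperiodic P.1) (hstat : IsStationaryLaw P.1 w) :
    HasSpectralGap P.1 w (spectralTheta P.1) where
  pos := hw
  sum_eq_one := hw1
  nonneg := P.2.1
  row_sum := Matrix.sum_row_of_mem_rowStochastic P.2
  stationary := hstat
  theta_nonneg := by
    obtain ⟨α, -, -, hr⟩ := (isGreatest_spectralTheta hw hrev hw1 hirr).1
    rw [hr]; exact abs_nonneg _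
  theta_lt_one := spectralTheta_lt_one hw hrev hw1 hirr haper
  contract := fun f hf => by
    obtain ⟨u, l, hu, ho, hp⟩ := exists_eigenbasis hw hrev
    -- Detailed balance makes `P` self-adjoint on `L²(w)`, so it acts on each eigencoefficient by
    -- its eigenvalue.
    have hsym : ∀ i, ∑ x, w x * (u i x * (P.1 *ᵥ f) x) = l i * ∑ x, w x * (u i x * f x) := by
      intro i
      have h1 : ∀ x, l i * u i x = ∑ y, P.1 x y * u i y := fun x => (congrFun (hu i) x).symm
      calc ∑ x, w x * (u i x * (P.1 *ᵥ f) x) = ∑ x, ∑ y, w x * P.1 x y * (u i x * f y) := by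
            simp only [mulVec, dotProduct, Finset.mul_sum]
            exact Finset.sum_congr rfl fun x _ => Finset.sum_congr rfl fun y _ => by ring
        _ = ∑ y, ∑ x, w y * P.1 y x * (u i x * f y) := by
            rw [Finset.sum_comm]
            exact Finset.sum_congr rfl fun x _ => Finset.sum_congr rfl fun y _ => by
              rw [hrev y x]
        _ = ∑ y, w y * ((l i * u i y) * f y) := by
            refine Finset.sum_congr rfl fun y _ => ?_
            rw [h1, Finset.sum_mul, Finset.mul_sum]
            exact Finset.sum_congr rfl fun x _ => by ring
        _ = _ := by
            rw [Finset.mul_sum]; exact Finset.sum_congr rfl fun x _ => by ring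
    have e1 : w ⬝ᵥ (P.1 *ᵥ f) ^ 2 = ∑ i, (∑ x, w x * (u i x * (P.1 *ᵥ f) x)) ^ 2 := hp _
    have e2 : w ⬝ᵥ f ^ 2 = ∑ i, (∑ x, w x * (u i x * f x)) ^ 2 := hp _
    rw [e1, e2, Finset.mul_sum]
    refine Finset.sum_le_sum fun i _ => ?_
    rw [hsym i]
    -- Eigenvectors for `1` are constant and see only the mean of `f`, which vanishes; all others
    -- contract by at most `θ`.
    by_cases hl : l i = 1
    · have hc : ∑ x, w x * (u i x * f x) = 0 := by
        have hi : ∀ x, u i x = u i i := fun x =>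
          harmonic_eq hirr (by rw [hu i, hl, one_smul]) x i
        calc ∑ x, w x * (u i x * f x) = u i i * (w ⬝ᵥ f) := by
              rw [dotProduct, Finset.mul_sum]
              exact Finset.sum_congr rfl fun x _ => by rw [hi x]; ring
          _ = 0 := by rw [hf, mul_zero]
      rw [hc]; simp
    · have hu0 : u i ≠ 0 := fun h => by
        have := ho i i; simp [h] at this
      have : |l i| ≤ spectralTheta P.1 := (isGreatest_spectralTheta hw hrev hw1 hirr).2
        ⟨l i, mem_spectrum_iff_exists.2 ⟨u i, hu0, hu i⟩, hl, rfl⟩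
      rw [mul_pow, ← sq_abs (l i)]
      gcongr

end Spectral

end ReversibleChain

/-! ### The spectral gap of two independent copies -/

namespace HasSpectralGap

open Matrix

variable {E : Type*} [Fintype E] {K : Matrix E E ℝ} {w : E → ℝ} {θ : ℝ}

/-- Jensen's inequality for each row, then stationarity. It handles the coordinate in which no
mean-zero condition is available. -/
theorem mean_sq_mulVec_le (hK : HasSpectralGap K w θ) (r : E → ℝ) :
    ∑ y, w y * (∑ z, K y z * r z) ^ 2 ≤ ∑ y, w y * r y ^ 2 := by
  have hJ : ∀ y, (∑ z, K y z * r z) ^ 2 ≤ ∑ z, K y z * r z ^ 2 := fun y => by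
    have := Finset.sum_sq_le_sum_mul_sum_of_sq_le_mul Finset.univ (r := fun z => K y z * r z)
      (f := fun z => K y z) (g := fun z => K y z * r z ^ 2) (fun z _ => hK.nonneg y z)
      (fun z _ => mul_nonneg (hK.nonneg y z) (sq_nonneg _)) (fun z _ => le_of_eq (by ring))
    rwa [hK.row_sum, one_mul] at this
  calc ∑ y, w y * (∑ z, K y z * r z) ^ 2 ≤ ∑ y, w y * ∑ z, K y z * r z ^ 2 :=
        Finset.sum_le_sum fun y _ => mul_le_mul_of_nonneg_left (hJ y) (hK.pos y).le
    _ = w ⬝ᵥ (K *ᵥ r ^ 2) := rfl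
    _ = _ := by rw [hK.mean_mulVec]; rfl

/-- The gap does not deteriorate. Split a mean-zero `H` into its `x`-average `A(y)`, itself mean
zero, and a remainder `R` of `x`-mean zero for each `y`. The parts stay orthogonal under `K ⊗ K`,
and each contracts by `θ`: `A` through the `y`-coordinate, `R` through the `x`-coordinate. -/
theorem kronecker (hK : HasSpectralGap K w θ) :
    HasSpectralGap (K ⊗ₖ K) (fun z : E × E => w z.1 * w z.2) θ where
  pos z := mul_pos (hK.pos _) (hK.pos _)
  sum_eq_one := by
    simp only [Fintype.sum_prod_type, ← Finset.mul_sum, hK.sum_eq_one, mul_one]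
  nonneg z z' := mul_nonneg (hK.nonneg _ _) (hK.nonneg _ _)
  row_sum z := by
    simp only [kroneckerMap_apply, Fintype.sum_prod_type, ← Finset.mul_sum, hK.row_sum, mul_one]
  stationary := by
    funext z
    have h : ∀ j, ∑ x, w x * K x j = w j := fun j => congrFun hK.stationary j
    simp only [vecMul, dotProduct, kroneckerMap_apply, Fintype.sum_prod_type]
    rw [← h z.1, ← h z.2, Finset.sum_mul_sum]
    exact Finset.sum_congr rfl fun x _ => Finset.sum_congr rfl fun y _ => by ring
  theta_nonneg := hK.theta_nonneg
  theta_lt_one := hK.theta_lt_one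
  contract := fun H hH => by
    have hst : ∀ j, ∑ x, w x * K x j = w j := fun j => congrFun hK.stationary j
    set A : E → ℝ := fun y => ∑ x, w x * H (x, y) with hA
    set R : E → E → ℝ := fun x y => H (x, y) - A y with hR
    have hR0 : ∀ y, ∑ x, w x * R x y = 0 := fun y => by
      simp only [hR, mul_sub, Finset.sum_sub_distrib, ← Finset.sum_mul, hK.sum_eq_one, one_mul]
      rw [hA, sub_self]
    -- Pythagoras for functions constant in `x` and functions of `x`-mean zero
    have pyth : ∀ (a : E → ℝ) (r : E → E → ℝ), (∀ y, ∑ x, w x * r x y = 0) →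
        ∑ y, w y * ∑ x, w x * (a y + r x y) ^ 2 =
          (w ⬝ᵥ a ^ 2) + ∑ y, w y * ∑ x, w x * r x y ^ 2 := by
      intro a r hr
      rw [dotProduct, ← Finset.sum_add_distrib]
      refine Finset.sum_congr rfl fun y _ => ?_
      rw [Pi.pow_apply, ← mul_add]
      congr 1
      calc ∑ x, w x * (a y + r x y) ^ 2
          = a y ^ 2 * ∑ x, w x + 2 * a y * ∑ x, w x * r x y + ∑ x, w x * r x y ^ 2 := by
            simp only [Finset.mul_sum, ← Finset.sum_add_distrib]
            exact Finset.sum_congr rfl fun x _ => by ring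
        _ = _ := by rw [hr, hK.sum_eq_one]; ring
    -- `U` applies `K` to `R` in the second coordinate and `V` then applies it in the first; both
    -- preserve the vanishing `x`-means.
    set U : E → E → ℝ := fun x y => ∑ y', K y y' * R x y' with hU
    set V : E → E → ℝ := fun x y => ∑ x', K x x' * U x' y with hV
    have hU0 : ∀ y, ∑ x, w x * U x y = 0 := fun y => by
      calc ∑ x, w x * U x y = ∑ y', K y y' * ∑ x, w x * R x y' := by
            simp only [hU, Finset.mul_sum]
            rw [Finset.sum_comm]
            exact Finset.sum_congr rfl fun x _ => Finset.sum_congr rfl fun z _ => by ring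
        _ = 0 := by simp [hR0]
    have hV0 : ∀ y, ∑ x, w x * V x y = 0 := fun y => by
      have := hK.mean_mulVec (fun x => U x y)
      simp only [dotProduct, mulVec] at this
      rw [hU0] at this
      exact this
    have hKH : ∀ x y, ((K ⊗ₖ K) *ᵥ H) (x, y) = (K *ᵥ A) y + V x y := by
      intro x y
      have h1 : (K *ᵥ A) y = ∑ x', K x x' * ∑ y', K y y' * A y' := by
        rw [← Finset.sum_mul, hK.row_sum, one_mul]; rfl
      rw [h1, hV, ← Finset.sum_add_distrib]
      simp only [mulVec, dotProduct, kroneckerMap_apply, Fintype.sum_prod_type]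
      refine Finset.sum_congr rfl fun x' _ => ?_
      rw [← mul_add, hU, ← Finset.sum_add_distrib, Finset.mul_sum]
      refine Finset.sum_congr rfl fun y' _ => ?_
      simp only [hR]; ring
    have hswap : ∀ G : E × E → ℝ, (fun z : E × E => w z.1 * w z.2) ⬝ᵥ G ^ 2 =
        ∑ y, w y * ∑ x, w x * G (x, y) ^ 2 := by
      intro G
      simp only [dotProduct, Fintype.sum_prod_type, Pi.pow_apply, Finset.mul_sum]
      rw [Finset.sum_comm]
      exact Finset.sum_congr rfl fun x _ => Finset.sum_congr rfl fun z _ => by ring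
    have hN1 : ∑ y, w y * ∑ x, w x * H (x, y) ^ 2 =
        (w ⬝ᵥ A ^ 2) + ∑ y, w y * ∑ x, w x * R x y ^ 2 := by
      rw [← pyth A R hR0]
      simp only [hR, add_sub_cancel]
    have hAm : w ⬝ᵥ A = 0 := by
      rw [← hH]
      simp only [dotProduct, hA, Fintype.sum_prod_type, Finset.mul_sum]
      rw [Finset.sum_comm]
      exact Finset.sum_congr rfl fun x _ => Finset.sum_congr rfl fun z _ => by ring
    have c1 := hK.contract A hAm
    have c2 : ∑ y, w y * ∑ x, w x * V x y ^ 2 ≤ θ ^ 2 * ∑ y, w y * ∑ x, w x * R x y ^ 2 := by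
      calc ∑ y, w y * ∑ x, w x * V x y ^ 2
          ≤ ∑ y, w y * (θ ^ 2 * ∑ x, w x * U x y ^ 2) := by
            refine Finset.sum_le_sum fun y _ => mul_le_mul_of_nonneg_left ?_ (hK.pos y).le
            exact hK.contract (fun x => U x y) (hU0 y)
        _ = θ ^ 2 * ∑ x, w x * ∑ y, w y * U x y ^ 2 := by
            simp only [Finset.mul_sum]
            rw [Finset.sum_comm]
            exact Finset.sum_congr rfl fun x _ => Finset.sum_congr rfl fun z _ => by ring
        _ ≤ θ ^ 2 * ∑ x, w x * ∑ y, w y * R x y ^ 2 := by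
            refine mul_le_mul_of_nonneg_left (Finset.sum_le_sum fun x _ =>
              mul_le_mul_of_nonneg_left ?_ (hK.pos x).le) (sq_nonneg _)
            exact hK.mean_sq_mulVec_le (R x)
        _ = _ := by
            congr 1
            simp only [Finset.mul_sum]
            rw [Finset.sum_comm]
            exact Finset.sum_congr rfl fun x _ => Finset.sum_congr rfl fun z _ => by ring
    rw [hswap, hswap, hN1]
    simp only [hKH]
    rw [pyth _ _ hV0, mul_add]
    exact add_le_add c1 c2

end HasSpectralGap

/-! ### Stationary Markov measures on path space -/

section Weights

variable {S : Type*} [Fintype S] [MeasurableSpace S]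

theorem integral_weightMeasure [MeasurableSingletonClass S] {F : Type*} [NormedAddCommGroup F]
    [NormedSpace ℝ F] [CompleteSpace F] (w : S → ℝ) (h0 : ∀ i, 0 ≤ w i) (f : S → F) :
    ∫ s, f s ∂(weightMeasure w) = ∑ i, w i • f i := by
  rw [weightMeasure, integral_finsetSum_measure]
  · refine Finset.sum_congr rfl fun i _ => ?_
    rw [integral_smul_measure, integral_dirac, ENNReal.toReal_ofReal (h0 i)]
  · intro i _
    exact (integrable_dirac (by simp)).smul_measure ENNReal.ofReal_ne_top

instance isProbabilityMeasure_weightMeasure_stdSimplex (π : stdSimplex ℝ S) :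
    IsProbabilityMeasure (weightMeasure π.1) :=
  isProbabilityMeasure_weightMeasure _ π.2.1 π.2.2

end Weights

namespace MarkovMeasure

open Matrix

variable {S : Type*} [Fintype S] [DecidableEq S] [MeasurableSpace S] [DiscreteMeasurableSpace S]
  (P : Matrix.rowStochastic ℝ S) (π : stdSimplex ℝ S)

instance : IsProbabilityMeasure (markovMeasure P π) := by
  unfold markovMeasure; infer_instance

theorem map_zero : (markovMeasure P π).map (fun x => x 0) = weightMeasure π.1 := by
  have h : (fun x : ℕ → S => x 0) =
      (MeasurableEquiv.piUnique (fun _ : Finset.Iic 0 => S)) ∘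
        (Preorder.frestrictLe (π := fun _ : ℕ => S) 0) := rfl
  rw [h, ← Measure.map_map (by fun_prop) (by fun_prop), markovMeasure, Kernel.trajMeasure,
    Measure.map_comp _ _ (by fun_prop), Kernel.traj_map_frestrictLe, Kernel.partialTraj_self,
    Measure.id_comp, Measure.map_map (by fun_prop) (by fun_prop)]
  exact Measure.map_id

/-- The Markov property, for an observable `F` of the path up to time `n`. -/
theorem integral_step {𝕜 : Type*} [RCLike 𝕜] (n : ℕ) (F : (ℕ → S) → 𝕜)
    (hF : ∀ x y : ℕ → S, (∀ i ≤ n, x i = y i) → F x = F y) (f : S → 𝕜) :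
    ∫ x, F x * f (x (n + 1)) ∂(markovMeasure P π) =
      ∫ x, F x * (∑ j, (P.1 (x n) j : 𝕜) * f j) ∂(markovMeasure P π) := by
  set κ : (n : ℕ) → Kernel ((i : Finset.Iic n) → S) S := fun n => (transitionKernel P).comap
      (fun x : (i : Finset.Iic n) → S => x ⟨n, Finset.mem_Iic.2 le_rfl⟩) (measurable_pi_apply _)
    with hκ
  -- The observable is read from the finite history by freezing the path after time `n`, so it
  -- becomes a function on a finite space.
  set G : ((i : Finset.Iic n) → S) → 𝕜 :=
    fun y => F fun i => y ⟨min i n, Finset.mem_Iic.2 (min_le_right _ _)⟩ with hGdef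
  have hG : ∀ x : ℕ → S, F x = G (Preorder.frestrictLe (π := fun _ : ℕ => S) n x) := fun x =>
    hF _ _ fun i hi => by simp [min_eq_left hi]
  simp only [hG]
  have key := Kernel.map_frestrictLe_trajMeasure_compProd_eq_map_trajMeasure (X := fun _ => S)
    (κ := κ) (μ₀ := weightMeasure π.1) (a := n)
  change (markovMeasure P π).map _ ⊗ₘ κ n = (markovMeasure P π).map _ at key
  have h1 : ∫ x, G (Preorder.frestrictLe (π := fun _ : ℕ => S) n x) * f (x (n + 1))
      ∂(markovMeasure P π) = ∫ p, G p.1 * f p.2 ∂((markovMeasure P π).map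
        (fun x => (Preorder.frestrictLe (π := fun _ : ℕ => S) n x, x (n + 1)))) := by
    rw [integral_map (by fun_prop) (Measurable.of_discrete.aestronglyMeasurable)]
  have : IsProbabilityMeasure ((markovMeasure P π).map
      (Preorder.frestrictLe (π := fun _ : ℕ => S) n)) :=
    Measure.isProbabilityMeasure_map (by fun_prop)
  rw [h1, ← key, Measure.integral_compProd (Integrable.of_finite),
    integral_map (by fun_prop) (Measurable.of_discrete.aestronglyMeasurable)]
  refine integral_congr_ae (Eventually.of_forall fun x => ?_)
  simp only [hκ, Kernel.comap_apply]
  change ∫ s, G (Preorder.frestrictLe (π := fun _ : ℕ => S) n x) * f s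
    ∂(weightMeasure (P.1 (x n))) = _
  rw [integral_weightMeasure _ (P.2.1 _), Finset.mul_sum]
  refine Finset.sum_congr rfl fun j _ => ?_
  rw [RCLike.real_smul_eq_coe_mul]; ring

theorem integral_step_real (n : ℕ) (F : (ℕ → S) → ℝ)
    (hF : ∀ x y : ℕ → S, (∀ i ≤ n, x i = y i) → F x = F y) (f : S → ℝ) :
    ∫ x, F x * f (x (n + 1)) ∂(markovMeasure P π) =
      ∫ x, F x * (P.1 *ᵥ f) (x n) ∂(markovMeasure P π) :=
  integral_step (𝕜 := ℝ) P π n F hF f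

theorem integral_zero {F : Type*} [NormedAddCommGroup F] [NormedSpace ℝ F] [CompleteSpace F]
    (f : S → F) : ∫ x, f (x 0) ∂(markovMeasure P π) = ∑ i, π.1 i • f i := by
  have hm : Measurable fun x : ℕ → S => x 0 := measurable_pi_apply 0
  rw [← integral_weightMeasure π.1 π.2.1 f, ← map_zero P π,
    integral_map hm.aemeasurable]
  exact (StronglyMeasurable.of_discrete).aestronglyMeasurable

omit [Fintype S] [DecidableEq S] [DiscreteMeasurableSpace S] in
theorem measurable_leftShift : Measurable (leftShift : (ℕ → S) → ℕ → S) :=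
  measurable_pi_lambda _ fun t => measurable_pi_apply (t + 1)

/-- The paths that agree with `a` up to time `n`. -/
def pathCylinder (a : ℕ → S) (n : ℕ) : Set (ℕ → S) := {x | ∀ i ≤ n, x i = a i}

omit [Fintype S] [DecidableEq S] in
theorem measurableSet_pathCylinder (a : ℕ → S) (n : ℕ) : MeasurableSet (pathCylinder a n) := by
  have : pathCylinder a n = ⋂ i ∈ Finset.Iic n, (fun x : ℕ → S => x i) ⁻¹' {a i} := by
    ext x; simp [pathCylinder]
  rw [this]
  exact Finset.measurableSet_biInter _ fun i _ => measurable_pi_apply i (.singleton _)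

omit [Fintype S] [DecidableEq S] [MeasurableSpace S] [DiscreteMeasurableSpace S] in
theorem mem_pathCylinder_succ {a x : ℕ → S} {n : ℕ} :
    x ∈ pathCylinder a (n + 1) ↔ x ∈ pathCylinder a n ∧ x (n + 1) = a (n + 1) :=
  ⟨fun h => ⟨fun i hi => h i (by omega), h _ le_rfl⟩, fun h i hi => by
    rcases Nat.le_succ_iff.1 hi with h' | h'
    · exact h.1 i h'
    · rw [h']; exact h.2⟩

omit [DecidableEq S] in
-- A singleton in the finite space of histories is a cylinder, so the marginals up to every time
-- agree; uniqueness of the projective limit concludes.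
theorem measure_ext_pathCylinder {μ ν : Measure (ℕ → S)} [IsProbabilityMeasure μ]
    [IsProbabilityMeasure ν] (h : ∀ a n, μ.real (pathCylinder a n) = ν.real (pathCylinder a n)) :
    μ = ν := by
  have hμ : IsProjectiveLimit μ (fun I : Finset ℕ => μ.map I.restrict) := fun I => rfl
  have hfam : IsProjectiveMeasureFamily (α := fun _ : ℕ => S)
      (fun I : Finset ℕ => μ.map I.restrict) := fun I J hJI => by
    beta_reduce
    rw [Measure.map_map (Finset.measurable_restrict₂ hJI) (Finset.measurable_restrict I)]; rfl
  have hν : IsProjectiveLimit ν (fun I : Finset ℕ => μ.map I.restrict) := by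
    rw [isProjectiveLimit_nat_iff hfam]
    intro n
    refine Measure.ext_of_singleton fun y => ?_
    have hpre : (Preorder.frestrictLe (π := fun _ : ℕ => S) n) ⁻¹' {y} =
        pathCylinder (fun i => y ⟨min i n, Finset.mem_Iic.2 (min_le_right _ _)⟩) n := by
      ext x
      constructor
      · intro hx i hi
        have hx : _ = y := hx
        simp [← hx, min_eq_left hi]
      · intro hx
        have hx : ∀ i ≤ n, _ := hx
        refine funext fun ⟨i, hi⟩ => ?_
        have := hx i (Finset.mem_Iic.1 hi)
        simp only [min_eq_left (Finset.mem_Iic.1 hi)] at this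
        exact this
    have h2 : μ.map (Preorder.frestrictLe (π := fun _ : ℕ => S) n) {y} =
        ν.map (Preorder.frestrictLe (π := fun _ : ℕ => S) n) {y} := by
      rw [Measure.map_apply (by fun_prop) (.singleton _), Measure.map_apply (by fun_prop)
        (.singleton _), hpre]
      exact (measureReal_eq_measureReal_iff).1 (h _ n)
    exact h2.symm
  exact hμ.unique hν

omit [Fintype S] [DecidableEq S] [MeasurableSpace S] [DiscreteMeasurableSpace S] in
theorem indicator_congr {g : (ℕ → S) → ℕ → S} {n m : ℕ}
    (hg : ∀ x y : ℕ → S, (∀ i ≤ m, x i = y i) → ∀ i ≤ n, g x i = g y i) (a x y : ℕ → S)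
    (h : ∀ i ≤ m, x i = y i) :
    (pathCylinder a n).indicator (1 : (ℕ → S) → ℝ) (g x) =
      (pathCylinder a n).indicator (1 : (ℕ → S) → ℝ) (g y) := by
  have : g x ∈ pathCylinder a n ↔ g y ∈ pathCylinder a n :=
    forall₂_congr fun i hi => by rw [hg x y h i hi]
  by_cases h1 : g y ∈ pathCylinder a n <;> simp [Set.indicator, this, h1]

omit [MeasurableSpace S] [DiscreteMeasurableSpace S] in
theorem mulVec_single_apply (j s : S) : (P.1 *ᵥ fun i => if i = j then 1 else 0) s = P.1 s j := by
  simp [mulVec, dotProduct]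

/-- The map `g` allows one argument to serve both the identity, with `m = n`, and the shift, with `m
= n + 1`. -/
theorem integral_indicator_pathCylinder_succ {g : (ℕ → S) → ℕ → S} {n m : ℕ}
    (hg : ∀ x y : ℕ → S, (∀ i ≤ m, x i = y i) → ∀ i ≤ n, g x i = g y i)
    (hgn : ∀ x, g x n = x m) (hgs : ∀ x, g x (n + 1) = x (m + 1)) (a : ℕ → S) :
    ∫ x, (pathCylinder a (n + 1)).indicator (1 : (ℕ → S) → ℝ) (g x) ∂(markovMeasure P π) =
      (∫ x, (pathCylinder a n).indicator (1 : (ℕ → S) → ℝ) (g x) ∂(markovMeasure P π)) *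
        P.1 (a n) (a (n + 1)) := by
  have := integral_step_real P π m (fun x => (pathCylinder a n).indicator (1 : (ℕ → S) → ℝ) (g x))
    (indicator_congr hg a) (fun s => if s = a (n + 1) then 1 else 0)
  simp only [mulVec_single_apply] at this
  rw [← integral_mul_const]
  refine Eq.trans (integral_congr_ae (Eventually.of_forall fun x => ?_))
    (this.trans (integral_congr_ae (Eventually.of_forall fun x => ?_)))
  · by_cases h1 : g x ∈ pathCylinder a n <;> by_cases h2 : x (m + 1) = a (n + 1) <;>
      simp [Set.indicator, mem_pathCylinder_succ, hgs, h1, h2]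
  · by_cases h1 : g x ∈ pathCylinder a n
    · have h2 : x m = a n := by rw [← hgn x]; exact h1 n le_rfl
      simp [Set.indicator, h1, h2]
    · simp [Set.indicator, h1]

theorem real_pathCylinder_succ (a : ℕ → S) (n : ℕ) :
    (markovMeasure P π).real (pathCylinder a (n + 1)) =
      (markovMeasure P π).real (pathCylinder a n) * P.1 (a n) (a (n + 1)) := by
  rw [← integral_indicator_one (measurableSet_pathCylinder a (n + 1)),
    ← integral_indicator_one (measurableSet_pathCylinder a n)]
  exact integral_indicator_pathCylinder_succ P π (g := id) (m := n)
    (fun _ _ h => h) (fun _ => rfl) (fun _ => rfl) a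

theorem real_pathCylinder_zero (a : ℕ → S) :
    (markovMeasure P π).real (pathCylinder a 0) = π.1 (a 0) := by
  rw [← integral_indicator_one (measurableSet_pathCylinder a 0)]
  have := integral_zero P π (fun s => if s = a 0 then (1 : ℝ) else 0)
  simp only [smul_eq_mul, mul_ite, mul_one, mul_zero, Finset.sum_ite_eq', Finset.mem_univ,
    if_true] at this
  rw [← this]
  congr 1; funext x
  simp [Set.indicator, pathCylinder]

/-- The initial law and the one-step recursion on cylinders characterize the chain. This criterion
yields both shift invariance and the identification of the paired chain. -/
theorem eq_markovMeasure {ν : Measure (ℕ → S)} [IsProbabilityMeasure ν]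
    (h0 : ∀ a, ν.real (pathCylinder a 0) = π.1 (a 0))
    (hs : ∀ a n, ν.real (pathCylinder a (n + 1)) =
      ν.real (pathCylinder a n) * P.1 (a n) (a (n + 1))) : ν = markovMeasure P π := by
  refine measure_ext_pathCylinder fun a n => ?_
  induction n with
  | zero => rw [h0, real_pathCylinder_zero]
  | succ n ih => rw [hs, ih, real_pathCylinder_succ]

variable {P π}

theorem measurePreserving_leftShift (hstat : IsStationaryLaw P.1 π.1) :
    MeasurePreserving leftShift (markovMeasure P π) (markovMeasure P π) := by
  refine ⟨measurable_leftShift, ?_⟩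
  have : IsProbabilityMeasure ((markovMeasure P π).map leftShift) :=
    Measure.isProbabilityMeasure_map measurable_leftShift.aemeasurable
  have hr : ∀ a n, ((markovMeasure P π).map leftShift).real (pathCylinder a n) =
      ∫ x, (pathCylinder a n).indicator (1 : (ℕ → S) → ℝ) (leftShift x) ∂(markovMeasure P π) :=
    fun a n => by
      rw [map_measureReal_apply measurable_leftShift (measurableSet_pathCylinder a n),
        ← integral_indicator_one (measurable_leftShift (measurableSet_pathCylinder a n))]
      rfl
  refine eq_markovMeasure P π (fun a => ?_) (fun a n => ?_)
  · have h1 := integral_step_real P π 0 (fun _ => 1) (fun _ _ _ => rfl)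
      (fun s => if s = a 0 then 1 else 0)
    have h2 := integral_zero P π (fun s => P.1 s (a 0))
    simp only [mulVec_single_apply, one_mul] at h1
    have h3 : ∑ i, π.1 i • P.1 i (a 0) = π.1 (a 0) := congrFun hstat (a 0)
    rw [hr, ← h3, ← h2, ← h1]
    refine integral_congr_ae (Eventually.of_forall fun x => ?_)
    simp [Set.indicator, pathCylinder, leftShift]
  · rw [hr, hr]
    exact integral_indicator_pathCylinder_succ P π (g := leftShift) (m := n + 1)
      (fun x y h i hi => h (i + 1) (by omega)) (fun _ => rfl) (fun _ => rfl) a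

/-- Two independent stationary chains, run together, are the product chain. -/
theorem map_zip_prod :
    ((markovMeasure P π).prod (markovMeasure P π)).map (fun p t => (p.1 t, p.2 t)) =
      markovMeasure (pairTransition P) (pairLaw π) := by
  have hm : Measurable (fun (p : (ℕ → S) × (ℕ → S)) t => (p.1 t, p.2 t)) := by fun_prop
  have : IsProbabilityMeasure (((markovMeasure P π).prod (markovMeasure P π)).map
      (fun p t => (p.1 t, p.2 t))) := Measure.isProbabilityMeasure_map hm.aemeasurable
  have hr : ∀ a n, (((markovMeasure P π).prod (markovMeasure P π)).map
      (fun p t => (p.1 t, p.2 t))).real (pathCylinder a n) =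
      (markovMeasure P π).real (pathCylinder (fun t => (a t).1) n) *
        (markovMeasure P π).real (pathCylinder (fun t => (a t).2) n) := fun a n => by
    rw [map_measureReal_apply hm (measurableSet_pathCylinder a n), ← measureReal_prod_prod]
    congr 1
    ext p
    constructor
    · intro h
      exact ⟨fun i hi => congrArg Prod.fst (h i hi), fun i hi => congrArg Prod.snd (h i hi)⟩
    · intro h i hi
      exact Prod.ext (h.1 i hi) (h.2 i hi)
  refine eq_markovMeasure _ _ (fun a => ?_) (fun a n => ?_)
  · rw [hr, real_pathCylinder_zero, real_pathCylinder_zero]; rfl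
  · rw [hr, hr, real_pathCylinder_succ, real_pathCylinder_succ]
    simp only [pairTransition, kroneckerMap_apply]; ring

variable (P π)

/-- A discrete Feynman–Kac formula: it writes the characteristic function of an additive functional
as a power of the twisted matrix. A general terminal `f` lets the induction peel off the last step.
-/
theorem integral_prod_mul_apply (φ : S → ℂ) (Q : Matrix S S ℂ)
    (hQ : ∀ s s', Q s s' = φ s * (P.1 s s' : ℂ)) (f : S → ℂ) (m : ℕ) :
    ∫ x, (∏ t ∈ Finset.range m, φ (x t)) * f (x m) ∂(markovMeasure P π) =
      ∑ s, (π.1 s : ℂ) * (Q ^ m *ᵥ f) s := by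
  induction m generalizing f with
  | zero =>
    simp only [Finset.range_zero, Finset.prod_empty, one_mul, pow_zero, one_mulVec]
    rw [integral_zero]
    simp
  | succ m ih =>
    have h1 := integral_step (𝕜 := ℂ) P π m (fun x => ∏ t ∈ Finset.range (m + 1), φ (x t))
      (fun x y h => Finset.prod_congr rfl fun t ht => by
        rw [h t (Nat.lt_succ_iff.1 (Finset.mem_range.1 ht))]) f
    rw [pow_succ Q, ← mulVec_mulVec, ← ih]
    refine h1.trans (integral_congr_ae (Eventually.of_forall fun x => ?_))
    simp only [mulVec, dotProduct, Finset.mul_sum, Finset.prod_range_succ, hQ]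
    exact Finset.sum_congr rfl fun j _ => by simp only [Complex.coe_algebraMap]; ring

theorem integral_mul_apply (h f : S → ℝ) (t : ℕ) :
    ∫ x, h (x 0) * f (x t) ∂(markovMeasure P π) = π.1 ⬝ᵥ (h * (P.1 ^ t *ᵥ f)) := by
  induction t generalizing f with
  | zero =>
    have := integral_zero P π (h * f)
    simpa [dotProduct] using this
  | succ t ih =>
    rw [pow_succ, ← mulVec_mulVec, ← ih]
    exact integral_step_real P π t (fun x => h (x 0))
      (fun x y hxy => by rw [hxy 0 (Nat.zero_le t)]) f

variable {P π}

omit [Fintype S] [DecidableEq S] [MeasurableSpace S] [DiscreteMeasurableSpace S] in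
theorem leftShift_iterate_apply (x : ℕ → S) (s k : ℕ) : leftShift^[s] x k = x (k + s) := by
  induction s generalizing k with
  | zero => rfl
  | succ s ih =>
    rw [Function.iterate_succ_apply', leftShift, ih]
    congr 1; omega

theorem integral_mul_apply_of_le (hstat : IsStationaryLaw P.1 π.1) (f : S → ℝ) {s t : ℕ}
    (hst : s ≤ t) :
    ∫ x, f (x s) * f (x t) ∂(markovMeasure P π) = π.1 ⬝ᵥ (f * (P.1 ^ (t - s) *ᵥ f)) := by
  rw [← integral_mul_apply]
  have hmp := (measurePreserving_leftShift hstat).iterate s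
  have hm : Measurable fun x : ℕ → S => f (x 0) * f (x (t - s)) :=
    ((Measurable.of_discrete (f := f)).comp (measurable_pi_apply 0)).mul
      ((Measurable.of_discrete (f := f)).comp (measurable_pi_apply (t - s)))
  conv_rhs => rw [← hmp.map_eq]
  rw [integral_map hmp.measurable.aemeasurable hm.aestronglyMeasurable]
  simp only [leftShift_iterate_apply, zero_add, Nat.sub_add_cancel hst]

omit [DecidableEq S] in
theorem integrable_apply_mul (μ : Measure (ℕ → S)) [IsProbabilityMeasure μ] (f g : S → ℝ)
    (s t : ℕ) : Integrable (fun x => f (x s) * g (x t)) μ := by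
  have hm : Measurable fun x : ℕ → S => (x s, x t) := by fun_prop
  exact (integrable_map_measure (f := fun x : ℕ → S => (x s, x t))
    (g := fun p : S × S => f p.1 * g p.2) (Measurable.of_discrete.aestronglyMeasurable)
    hm.aemeasurable).1 Integrable.of_finite

end MarkovMeasure

/-! ### Moments and characteristic functions of the mismatch average -/

namespace Mismatch

open Matrix MarkovMeasure

variable {E : Type*} [Fintype E] [DecidableEq E]

/-- The centred mismatch function. -/
noncomputable def centered (π : stdSimplex ℝ E) : E × E → ℝ :=
  fun z => mismatch z - (pairLaw π).1 ⬝ᵥ mismatch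

theorem mean_centered (π : stdSimplex ℝ E) : (pairLaw π).1 ⬝ᵥ centered π = 0 := by
  have h := (pairLaw π).2.2
  simp only [dotProduct, centered, mul_sub, Finset.sum_sub_distrib, ← Finset.sum_mul]
  rw [h]; simp

omit [Fintype E] in
theorem mismatch_nonneg (z : E × E) : 0 ≤ mismatch z := by unfold mismatch; split_ifs <;> norm_num

omit [Fintype E] in
theorem mismatch_le_one (z : E × E) : mismatch z ≤ 1 := by unfold mismatch; split_ifs <;> norm_num

theorem mean_mismatch_mem (π : stdSimplex ℝ E) :
    0 ≤ (pairLaw π).1 ⬝ᵥ mismatch ∧ (pairLaw π).1 ⬝ᵥ mismatch ≤ 1 := by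
  constructor
  · exact Finset.sum_nonneg fun z _ => mul_nonneg ((pairLaw π).2.1 z) (mismatch_nonneg z)
  · rw [← (pairLaw π).2.2]
    exact Finset.sum_le_sum fun z _ => mul_le_of_le_one_right ((pairLaw π).2.1 z) (mismatch_le_one z)

theorem abs_centered_le (π : stdSimplex ℝ E) (z : E × E) : |centered π z| ≤ 1 := by
  have h := mean_mismatch_mem π
  have h1 := mismatch_nonneg z
  have h2 := mismatch_le_one z
  rw [abs_le, centered]; constructor <;> linarith

theorem centered_ne_zero [Nontrivial E] (π : stdSimplex ℝ E) : centered π ≠ 0 := by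
  intro h
  obtain ⟨i, j, hij⟩ := exists_pair_ne E
  have h1 := congrFun h (i, i)
  have h2 := congrFun h (i, j)
  simp only [centered, mismatch, Pi.zero_apply, ne_eq, hij, not_true_eq_false, not_false_eq_true,
    if_true, if_false] at h1 h2
  linarith

variable [MeasurableSpace E] [DiscreteMeasurableSpace E]

omit [DecidableEq E] in
theorem weightMeasure_prod (π : stdSimplex ℝ E) :
    (weightMeasure π.1).prod (weightMeasure π.1) = weightMeasure (pairLaw π).1 := by
  have : IsProbabilityMeasure (weightMeasure (pairLaw π).1) :=
    isProbabilityMeasure_weightMeasure_stdSimplex (pairLaw π)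
  have hr : ∀ {S : Type _} [Fintype S] [MeasurableSpace S] [DiscreteMeasurableSpace S]
      (w : stdSimplex ℝ S) (i : S), weightMeasure w.1 {i} = ENNReal.ofReal (w.1 i) := by
    classical
    intro S _ _ _ w i
    simp only [weightMeasure, Measure.coe_finsetSum, Finset.sum_apply, Measure.smul_apply,
      smul_eq_mul]
    rw [Finset.sum_eq_single i]
    · simp
    · intro b _ hb; simp [hb]
    · simp
  refine Measure.ext_of_singleton fun z => ?_
  rw [hr, ← Set.singleton_prod_singleton, Measure.prod_prod, hr, hr,
    ← ENNReal.ofReal_mul (π.2.1 _)]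
  rfl

theorem mismatchVariance_eq (π : stdSimplex ℝ E) :
    mismatchVariance π = (pairLaw π).1 ⬝ᵥ centered π ^ 2 := by
  rw [mismatchVariance, weightMeasure_prod, variance_eq_integral (Measurable.of_discrete.aemeasurable),
    integral_weightMeasure _ (pairLaw π).2.1, integral_weightMeasure _ (pairLaw π).2.1]
  rfl

variable {P : Matrix.rowStochastic ℝ E} {π : stdSimplex ℝ E} {θ : ℝ}

omit [MeasurableSpace E] [DiscreteMeasurableSpace E] in
theorem hasSpectralGap_pair (hK : HasSpectralGap P.1 π.1 θ) :
    HasSpectralGap (pairTransition P).1 (pairLaw π).1 θ := hK.kronecker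

theorem integral_apply (P : Matrix.rowStochastic ℝ E) (π : stdSimplex ℝ E) (f : E → ℝ) (t : ℕ) :
    ∫ x, f (x t) ∂(markovMeasure P π) = π.1 ⬝ᵥ (P.1 ^ t *ᵥ f) := by
  have := integral_mul_apply P π (fun _ => 1) f t
  simp only [one_mul] at this
  rw [this]; congr 1; funext x; simp

theorem mismatchCov_eq (hK : HasSpectralGap P.1 π.1 θ) (t : ℕ) :
    mismatchCov P π t = (pairLaw π).1 ⬝ᵥ
      (centered π * ((pairTransition P).1 ^ t *ᵥ centered π)) := by
  have hK2 := hasSpectralGap_pair hK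
  rw [mismatchCov, covariance]
  have h0 : ∀ s, ∫ x, mismatch (x s) ∂(markovMeasure (pairTransition P) (pairLaw π)) =
      (pairLaw π).1 ⬝ᵥ mismatch := fun s => by
    rw [integral_apply, hK2.mean_pow]
  rw [h0, h0, ← integral_mul_apply]
  rfl

theorem mismatchSigmaSq_eq (hK : HasSpectralGap P.1 π.1 θ) :
    mismatchSigmaSq P π =
      HasSpectralGap.asympVar (pairTransition P).1 (pairLaw π).1 (centered π) := by
  have hK2 := hasSpectralGap_pair hK
  rw [mismatchSigmaSq, mismatchVariance_eq, HasSpectralGap.asympVar,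
    ← (hK2.hasSum_cov (mean_centered π)).tsum_eq]
  simp only [mismatchCov_eq hK]

theorem summable_mismatchCov (hK : HasSpectralGap P.1 π.1 θ) :
    Summable fun t : ℕ => mismatchCov P π (t + 1) := by
  simp only [mismatchCov_eq hK]
  exact ((hasSpectralGap_pair hK).hasSum_cov (mean_centered π)).summable

theorem mismatchSigmaSq_pos [Nontrivial E] (hK : HasSpectralGap P.1 π.1 θ) :
    0 < mismatchSigmaSq P π := by
  rw [mismatchSigmaSq_eq hK]
  exact (hasSpectralGap_pair hK).asympVar_pos (mean_centered π) (centered_ne_zero π)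

/-- The exponent is `|s - t|`, free of truncated subtraction. The past contributes at most `θ/(1-θ)`
and the present with the future at most `1/(1-θ)`. -/
theorem sum_pow_dist_le {θ : ℝ} (h0 : 0 ≤ θ) (h1 : θ < 1) (m s : ℕ) (hs : s < m) :
    ∑ t ∈ Finset.range m, θ ^ (max s t - min s t) ≤ (1 + θ) / (1 - θ) := by
  have hgeo : ∀ n : ℕ, ∑ k ∈ Finset.range n, θ ^ k ≤ 1 / (1 - θ) := fun n => by
    rw [one_div, ← tsum_geometric_of_lt_one h0 h1]
    exact (summable_geometric_of_lt_one h0 h1).sum_le_tsum _ fun k _ => pow_nonneg h0 k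
  rw [← Finset.sum_range_add_sum_Ico _ hs.le]
  have e1 : ∑ t ∈ Finset.range s, θ ^ (max s t - min s t) = θ * ∑ k ∈ Finset.range s, θ ^ k := by
    rw [← Finset.sum_range_reflect, Finset.mul_sum]
    refine Finset.sum_congr rfl fun t ht => ?_
    have := Finset.mem_range.1 ht
    rw [← pow_succ']
    congr 1; omega
  have e2 : ∑ t ∈ Finset.Ico s m, θ ^ (max s t - min s t) = ∑ k ∈ Finset.range (m - s), θ ^ k := by
    rw [Finset.sum_Ico_eq_sum_range]
    exact Finset.sum_congr rfl fun t _ => by congr 1; omega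
  rw [e1, e2]
  have h2 := hgeo (m - s)
  have h3 := mul_le_mul_of_nonneg_left (hgeo s) h0
  calc _ ≤ θ * (1 / (1 - θ)) + 1 / (1 - θ) := add_le_add h3 h2
    _ = _ := by ring

/-- By stationarity and the gap, the covariance at times `s`, `t` is at most `‖f‖² θ^|s-t|`; each
row of the double sum is then a two-sided geometric series. -/
theorem integral_sum_sq_le (hK : HasSpectralGap P.1 π.1 θ) {f : E → ℝ} (hf : π.1 ⬝ᵥ f = 0)
    (m : ℕ) :
    ∫ x, (∑ t ∈ Finset.range m, f (x t)) ^ 2 ∂(markovMeasure P π) ≤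
      m * ((π.1 ⬝ᵥ f ^ 2) * ((1 + θ) / (1 - θ))) := by
  have hV := hK.mean_sq_nonneg f
  have hc : ∀ s t : ℕ, ∫ x, f (x s) * f (x t) ∂(markovMeasure P π) ≤
      (π.1 ⬝ᵥ f ^ 2) * θ ^ (max s t - min s t) := by
    intro s t
    rcases le_total s t with h | h
    · rw [integral_mul_apply_of_le hK.stationary f h, max_eq_right h, min_eq_left h,
        mul_comm (π.1 ⬝ᵥ f ^ 2)]
      exact (le_abs_self _).trans (hK.abs_mean_mul_pow_le _ hf)
    · have : ∀ x : ℕ → E, f (x s) * f (x t) = f (x t) * f (x s) := fun x => mul_comm _ _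
      simp only [this]
      rw [integral_mul_apply_of_le hK.stationary f h, max_eq_left h, min_eq_right h,
        mul_comm (π.1 ⬝ᵥ f ^ 2)]
      exact (le_abs_self _).trans (hK.abs_mean_mul_pow_le _ hf)
  have hexp : ∀ x : ℕ → E, (∑ t ∈ Finset.range m, f (x t)) ^ 2 =
      ∑ s ∈ Finset.range m, ∑ t ∈ Finset.range m, f (x s) * f (x t) := fun x => by
    rw [sq, Finset.sum_mul_sum]
  simp only [hexp]
  rw [integral_finsetSum _ fun s _ => integrable_finsetSum _ fun t _ =>
    integrable_apply_mul _ f f s t]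
  calc _ ≤ ∑ s ∈ Finset.range m, (π.1 ⬝ᵥ f ^ 2) * ((1 + θ) / (1 - θ)) := by
        refine Finset.sum_le_sum fun s hs => ?_
        rw [integral_finsetSum _ fun t _ => integrable_apply_mul _ f f s t]
        refine (Finset.sum_le_sum fun t _ => hc s t).trans ?_
        rw [← Finset.mul_sum]
        exact mul_le_mul_of_nonneg_left (sum_pow_dist_le hK.theta_nonneg hK.theta_lt_one m s
          (Finset.mem_range.1 hs)) hV
    _ = _ := by simp

/-- The law of `B_m(x₁, x₂)` for independent `x₁`, `x₂` with law `μ`. -/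
noncomputable def averageLaw (μ : Measure (ℕ → E)) (m : ℕ) : Measure ℝ :=
  (μ.prod μ).map fun p => mismatchAverage m p.1 p.2

omit [Fintype E] in
theorem measurable_mismatchAverage [Countable E] (m : ℕ) :
    Measurable fun p : (ℕ → E) × (ℕ → E) => mismatchAverage m p.1 p.2 := by
  unfold mismatchAverage
  refine Measurable.const_mul (Finset.measurable_fun_sum _ fun t _ => ?_) _
  exact (Measurable.of_discrete (f := (mismatch : E × E → ℝ))).comp (by fun_prop)

instance (μ : Measure (ℕ → E)) [IsProbabilityMeasure μ] (m : ℕ) :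
    IsProbabilityMeasure (averageLaw μ m) :=
  Measure.isProbabilityMeasure_map (measurable_mismatchAverage m).aemeasurable

omit [Fintype E] in
theorem measurable_average [Countable E] (m : ℕ) : Measurable fun z : ℕ → E × E =>
    1 / (m : ℝ) * ∑ t ∈ Finset.range m, mismatch (z t) := by
  refine Measurable.const_mul (Finset.measurable_fun_sum _ fun t _ => ?_) _
  exact (Measurable.of_discrete (f := (mismatch : E × E → ℝ))).comp (measurable_pi_apply t)

/-- This turns the two-particle average into an additive functional of the single chain `P ⊗ P`,
where the gap applies. -/
theorem averageLaw_eq (P : Matrix.rowStochastic ℝ E) (π : stdSimplex ℝ E) (m : ℕ) :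
    averageLaw (markovMeasure P π) m = (markovMeasure (pairTransition P) (pairLaw π)).map
      fun z => 1 / (m : ℝ) * ∑ t ∈ Finset.range m, mismatch (z t) := by
  rw [← map_zip_prod, Measure.map_map (measurable_average m) (by fun_prop)]
  rfl

omit [MeasurableSpace E] [DiscreteMeasurableSpace E] in
theorem average_sub (π : stdSimplex ℝ E) {m : ℕ} (hm : m ≠ 0) (z : ℕ → E × E) :
    1 / (m : ℝ) * ∑ t ∈ Finset.range m, mismatch (z t) - (pairLaw π).1 ⬝ᵥ mismatch =
      1 / (m : ℝ) * ∑ t ∈ Finset.range m, centered π (z t) := by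
  have : (m : ℝ) ≠ 0 := Nat.cast_ne_zero.2 hm
  simp only [centered, Finset.sum_sub_distrib, Finset.sum_const, Finset.card_range, nsmul_eq_mul]
  field_simp

theorem integral_sq_averageLaw_le (hK : HasSpectralGap P.1 π.1 θ) {m : ℕ} (hm : m ≠ 0) :
    ∫ b, (b - (pairLaw π).1 ⬝ᵥ mismatch) ^ 2 ∂(averageLaw (markovMeasure P π) m) ≤
      mismatchVariance π * (1 + θ) / (m * (1 - θ)) := by
  have hm0 : (0 : ℝ) < m := Nat.cast_pos.2 (Nat.pos_of_ne_zero hm)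
  have h1 := integral_sum_sq_le (hasSpectralGap_pair hK) (mean_centered π) m
  rw [averageLaw_eq, integral_map (measurable_average m).aemeasurable (by fun_prop)]
  simp only [average_sub π hm, mul_pow]
  rw [integral_const_mul, mismatchVariance_eq]
  have h2 : 0 < 1 - θ := by linarith [hK.theta_lt_one]
  calc _ ≤ (1 / (m : ℝ)) ^ 2 * _ := mul_le_mul_of_nonneg_left h1 (by positivity)
    _ = _ := by field_simp

/-- The characteristic function of the centred and rescaled mismatch average. -/
theorem tendsto_integral_exp (hK : HasSpectralGap P.1 π.1 θ) (ξ : ℝ) :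
    Tendsto (fun m : ℕ => ∫ b, Complex.exp ((ξ * (√m * (b - (pairLaw π).1 ⬝ᵥ mismatch)) : ℝ) *
      Complex.I) ∂(averageLaw (markovMeasure P π) m)) atTop
      (𝓝 (Complex.exp ((-(ξ ^ 2 * (mismatchSigmaSq P π / 2)) : ℝ)))) := by
  have h := (hasSpectralGap_pair hK).tendsto_twist_pow (mean_centered π) (abs_centered_le π) ξ
  rw [← mismatchSigmaSq_eq hK] at h
  refine h.congr' ?_
  filter_upwards [eventually_ne_atTop 0] with m hm
  have hm0 : (0 : ℝ) < m := Nat.cast_pos.2 (Nat.pos_of_ne_zero hm)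
  rw [averageLaw_eq, integral_map (measurable_average m).aemeasurable (by fun_prop)]
  rw [← integral_prod_mul_apply (pairTransition P) (pairLaw π)
    (fun z => Complex.exp ((ξ / √m * centered π z : ℝ) * Complex.I))
    (HasSpectralGap.twist (pairTransition P).1 (centered π) (ξ / √m)) (fun _ _ => rfl)]
  refine integral_congr_ae (Eventually.of_forall fun z => ?_)
  simp only [Pi.one_apply, mul_one, average_sub π hm]
  rw [← Complex.exp_sum, ← Finset.sum_mul, ← Complex.ofReal_sum, ← Finset.mul_sum]
  congr 3
  rw [div_mul_eq_mul_div, div_eq_iff (Real.sqrt_pos.2 hm0).ne']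
  have := Real.mul_self_sqrt hm0.le
  field_simp
  rw [sq, this]

end Mismatch

/-! ### Mean differences of independent copies and the planar Wasserstein distance -/

namespace MeanDifference

theorem integral_Ioi_mul_exp {v : ℝ} (hv : 0 < v) :
    ∫ x in Set.Ioi (0 : ℝ), x * Real.exp (-x ^ 2 / (2 * v)) = v := by
  have h := integral_rpow_mul_exp_neg_mul_rpow (p := 2) (q := 1) (b := 1 / (2 * v))
    (by norm_num) (by norm_num) (by positivity)
  have e : ∀ x : ℝ, x ^ (1 : ℝ) * Real.exp (-(1 / (2 * v)) * x ^ (2 : ℝ)) =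
      x * Real.exp (-x ^ 2 / (2 * v)) := fun x => by
    rw [Real.rpow_one, Real.rpow_two]; congr 2; ring
  simp only [e] at h
  rw [h]
  norm_num [Real.rpow_neg_one]
  ring

theorem lintegral_abs_gaussianReal {v : ℝ≥0} (hv : v ≠ 0) {c : ℝ} (hc : 0 ≤ c) :
    ∫⁻ x, ENNReal.ofReal (c * |x|) ∂(gaussianReal 0 v) =
      ENNReal.ofReal (c * √(2 * v / Real.pi)) := by
  have hv0 : (0 : ℝ) < v := by positivity
  have hint : Integrable (fun x : ℝ => c * |x|) (gaussianReal 0 v) :=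
    ((memLp_id_gaussianReal (μ := 0) (v := v) 1).integrable (by simp)).abs.const_mul c
  rw [← ofReal_integral_eq_lintegral_ofReal hint
    (Eventually.of_forall fun x => mul_nonneg hc (abs_nonneg x)), integral_const_mul]
  congr 2
  rw [integral_gaussianReal_eq_integral_smul hv]
  have e : ∀ x : ℝ, gaussianPDFReal 0 v x • |x| =
      (fun y => (√(2 * Real.pi * v))⁻¹ * (y * Real.exp (-y ^ 2 / (2 * v)))) |x| := fun x => by
    simp only [gaussianPDFReal, smul_eq_mul, sub_zero, sq_abs]; ring
  rw [integral_congr_ae (Eventually.of_forall e), integral_comp_abs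
    (f := fun y => (√(2 * Real.pi * v))⁻¹ * (y * Real.exp (-y ^ 2 / (2 * v)))), integral_const_mul,
    integral_Ioi_mul_exp hv0]
  have hp := Real.pi_pos
  symm
  rw [Real.sqrt_eq_iff_mul_self_eq (by positivity) (by positivity)]
  have hs := Real.mul_self_sqrt (show 0 ≤ 2 * Real.pi * (v : ℝ) by positivity)
  have hs0 : 0 < √(2 * Real.pi * (v : ℝ)) := by positivity
  have : (2 * ((√(2 * Real.pi * v))⁻¹ * (v : ℝ))) * (2 * ((√(2 * Real.pi * v))⁻¹ * (v : ℝ))) =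
      4 * (v : ℝ) ^ 2 / (√(2 * Real.pi * v) * √(2 * Real.pi * v)) := by field_simp; norm_num
  rw [this, hs]; field_simp; norm_num

/-- The law of the rescaled difference of two independent copies. -/
noncomputable def differenceLaw (ρ : Measure ℝ) (r : ℝ) : Measure ℝ :=
  (ρ.prod ρ).map fun p => r * (p.1 - p.2)

instance (ρ : Measure ℝ) [IsProbabilityMeasure ρ] (r : ℝ) :
    IsProbabilityMeasure (differenceLaw ρ r) :=
  Measure.isProbabilityMeasure_map (by fun_prop)

/-- The centring `c` is free because it cancels in the difference; it lets centred limits be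
inserted in each factor. -/
theorem charFun_differenceLaw (ρ : Measure ℝ) [IsProbabilityMeasure ρ] (r c ξ : ℝ) :
    charFun (differenceLaw ρ r) ξ =
      (∫ b, Complex.exp ((ξ * (r * (b - c)) : ℝ) * Complex.I) ∂ρ) *
        ∫ b, Complex.exp ((-ξ * (r * (b - c)) : ℝ) * Complex.I) ∂ρ := by
  rw [charFun_apply_real, differenceLaw, integral_map (by fun_prop) (by fun_prop),
    ← integral_prod_mul]
  refine integral_congr_ae (Eventually.of_forall fun p => ?_)
  simp only
  rw [← Complex.exp_add]
  congr 1; push_cast; ring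

/-- Fatou's lemma for the mean differences of rescaled laws with Gaussian limit. -/
theorem le_liminf_lintegral {ρ : ℕ → Measure ℝ} [∀ m, IsProbabilityMeasure (ρ m)] {s c₀ : ℝ}
    (hs : 0 < s) (hφ : ∀ ξ : ℝ, Tendsto (fun m : ℕ =>
      ∫ b, Complex.exp ((ξ * (√m * (b - c₀)) : ℝ) * Complex.I) ∂(ρ m)) atTop
      (𝓝 (Complex.exp ((-(ξ ^ 2 * (s / 2)) : ℝ))))) {c : ℝ} (hc : 0 ≤ c) :
    ENNReal.ofReal (c * (2 * √s / √Real.pi)) ≤ liminf (fun m : ℕ =>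
      ∫⁻ p, ENNReal.ofReal (c * (√m * |p.1 - p.2|)) ∂((ρ m).prod (ρ m))) atTop := by
  -- The variances of the two independent limits add.
  set v : ℝ≥0 := (2 * s).toNNReal with hv
  have hv0 : v ≠ 0 := by rw [hv]; simpa using hs
  have hvs : (v : ℝ) = 2 * s := Real.coe_toNNReal _ (by positivity)
  set G : ProbabilityMeasure ℝ := ⟨gaussianReal 0 v, inferInstance⟩ with hG
  set D : ℕ → ProbabilityMeasure ℝ := fun m => ⟨differenceLaw (ρ m) (√m), inferInstance⟩ with hD
  have hlim : Tendsto D atTop (𝓝 G) := by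
    rw [ProbabilityMeasure.tendsto_iff_tendsto_charFun]
    intro ξ
    have h1 := (hφ ξ).mul (hφ (-ξ))
    simp only [hG, hD, ProbabilityMeasure.coe_mk]
    rw [charFun_gaussianReal]
    simp only [charFun_differenceLaw _ _ c₀]
    convert h1 using 2
    rw [← Complex.exp_add]
    congr 1
    have : (v : ℂ) = 2 * (s : ℂ) := by exact_mod_cast congrArg (fun r : ℝ => (r : ℂ)) hvs
    rw [this]; push_cast; ring
  -- Weak convergence bounds the measure of open sets from below, which suffices for a nonnegative
  -- continuous integrand, even an unbounded one.
  have h := lintegral_le_liminf_lintegral_of_forall_isOpen_measure_le_liminf_measure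
    (μ := (G : Measure ℝ)) (μs := fun m => (D m : Measure ℝ)) (f := fun x => c * |x|)
    (by fun_prop) (fun x => mul_nonneg hc (abs_nonneg x))
    (fun U hU => ProbabilityMeasure.le_liminf_measure_open_of_tendsto hlim hU)
  have e1 : c * (2 * √s / √Real.pi) = c * √(2 * v / Real.pi) := by
    rw [hvs, show 2 * (2 * s) / Real.pi = 2 ^ 2 * s / Real.pi by ring,
      Real.sqrt_div (by positivity), Real.sqrt_mul (by positivity), Real.sqrt_sq (by norm_num)]
  rw [e1, ← lintegral_abs_gaussianReal hv0 hc]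
  refine h.trans (le_of_eq ?_)
  congr 1; funext m
  simp only [hD, ProbabilityMeasure.coe_mk]
  rw [differenceLaw, lintegral_map (by fun_prop) (by fun_prop)]
  simp only [abs_mul, abs_of_nonneg (Real.sqrt_nonneg _)]

/-- Here `(E|b - b'|)² ≤ E(b - b')² = 2E(b - c)² - 2(E(b - c))²`, so any centre `c` will do. -/
theorem lintegral_abs_sub_le {ρ : Measure ℝ} [IsProbabilityMeasure ρ] (h2 : MemLp id 2 ρ)
    (c : ℝ) {K : ℝ} (hK : ∫ b, (b - c) ^ 2 ∂ρ ≤ K) :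
    ∫⁻ p, ENNReal.ofReal |p.1 - p.2| ∂(ρ.prod ρ) ≤ ENNReal.ofReal √(2 * K) := by
  have hb : MemLp (fun b : ℝ => b - c) 2 ρ := h2.sub (memLp_const c)
  have hL : MemLp (fun p : ℝ × ℝ => p.1 - c) 2 (ρ.prod ρ) :=
    hb.comp_measurePreserving measurePreserving_fst
  have hR : MemLp (fun p : ℝ × ℝ => p.2 - c) 2 (ρ.prod ρ) :=
    hb.comp_measurePreserving measurePreserving_snd
  have hD : MemLp (fun p : ℝ × ℝ => p.1 - p.2) 2 (ρ.prod ρ) := by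
    refine (hL.sub hR).congr_norm (by fun_prop) (Eventually.of_forall fun p => ?_)
    simp
  have hDa : MemLp (fun p : ℝ × ℝ => |p.1 - p.2|) 2 (ρ.prod ρ) := hD.abs
  have hint : Integrable (fun p : ℝ × ℝ => |p.1 - p.2|) (ρ.prod ρ) := hDa.integrable (by norm_num)
  rw [← ofReal_integral_eq_lintegral_ofReal hint (Eventually.of_forall fun p => abs_nonneg _)]
  refine ENNReal.ofReal_le_ofReal (Real.le_sqrt_of_sq_le ?_)
  -- Nonnegativity of the variance of `|b - b'|` plays the role of the Cauchy–Schwarz inequality.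
  have hvar := variance_nonneg (fun p : ℝ × ℝ => |p.1 - p.2|) (ρ.prod ρ)
  rw [variance_eq_sub hDa] at hvar
  have e0 : ∫ p, ((fun p : ℝ × ℝ => |p.1 - p.2|) ^ 2) p ∂(ρ.prod ρ) =
      ∫ p, ((p.1 - c) ^ 2 + (p.2 - c) ^ 2 - 2 * ((p.1 - c) * (p.2 - c))) ∂(ρ.prod ρ) := by
    refine integral_congr_ae (Eventually.of_forall fun p => ?_)
    simp only [Pi.pow_apply, sq_abs]; ring
  have i1 : ∫ p : ℝ × ℝ, (p.1 - c) ^ 2 ∂(ρ.prod ρ) = ∫ b, (b - c) ^ 2 ∂ρ := by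
    rw [integral_fun_fst (fun b => (b - c) ^ 2)]; simp
  have i2 : ∫ p : ℝ × ℝ, (p.2 - c) ^ 2 ∂(ρ.prod ρ) = ∫ b, (b - c) ^ 2 ∂ρ := by
    rw [integral_fun_snd (fun b => (b - c) ^ 2)]; simp
  have i3 : ∫ p : ℝ × ℝ, (p.1 - c) * (p.2 - c) ∂(ρ.prod ρ) = (∫ b, (b - c) ∂ρ) ^ 2 := by
    rw [integral_prod_mul (fun b => b - c) (fun b => b - c), sq]
  have e1 : ∫ p : ℝ × ℝ, ((p.1 - c) ^ 2 + (p.2 - c) ^ 2 - 2 * ((p.1 - c) * (p.2 - c)))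
      ∂(ρ.prod ρ) = 2 * ∫ b, (b - c) ^ 2 ∂ρ - 2 * (∫ b, (b - c) ∂ρ) ^ 2 := by
    have hLR : Integrable (fun p : ℝ × ℝ => 2 * ((p.1 - c) * (p.2 - c))) (ρ.prod ρ) :=
      (hL.integrable_mul hR).const_mul 2
    have hS : Integrable (fun p : ℝ × ℝ => (p.1 - c) ^ 2 + (p.2 - c) ^ 2) (ρ.prod ρ) :=
      hL.integrable_sq.add hR.integrable_sq
    rw [integral_sub hS hLR, integral_add hL.integrable_sq hR.integrable_sq, integral_const_mul,
      i1, i2, i3]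
    ring
  rw [e0, e1] at hvar
  nlinarith [sq_nonneg (∫ b, (b - c) ∂ρ)]

/-- The plane law of `(b, b)`, for `b` with law `ρ`. -/
noncomputable def diagonalLaw (ρ : Measure ℝ) : Measure (EuclideanSpace ℝ (Fin 2)) :=
  ρ.map fun b => !₂[b, b]

/-- The plane law of `(b, b')`, for independent `b`, `b'` with law `ρ`. -/
noncomputable def squareLaw (ρ : Measure ℝ) : Measure (EuclideanSpace ℝ (Fin 2)) :=
  (ρ.prod ρ).map fun p => !₂[p.1, p.2]

theorem measurable_pair {α : Type*} [MeasurableSpace α] {f g : α → ℝ} (hf : Measurable f)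
    (hg : Measurable g) :
    Measurable (fun a => !₂[f a, g a] : α → EuclideanSpace ℝ (Fin 2)) := by
  refine (WithLp.measurable_toLp 2 _).comp (measurable_pi_lambda _ fun i => ?_)
  fin_cases i
  · exact hf
  · exact hg

theorem measurable_coord (i : Fin 2) : Measurable fun z : EuclideanSpace ℝ (Fin 2) => z i :=
  (EuclideanSpace.proj (𝕜 := ℝ) i).measurable

theorem edist_eq_sqrt (x y : EuclideanSpace ℝ (Fin 2)) :
    edist x y = ENNReal.ofReal √((x 0 - y 0) ^ 2 + (x 1 - y 1) ^ 2) := by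
  rw [edist_dist, EuclideanSpace.dist_eq, Fin.sum_univ_two, Real.dist_eq, Real.dist_eq, sq_abs,
    sq_abs]

/-- The coupling keeps the first coordinate, so only the second moves, from `b` to `b'`. -/
theorem wasserstein1_le (ρ : Measure ℝ) [IsProbabilityMeasure ρ] :
    wasserstein1 (diagonalLaw ρ) (squareLaw ρ) ≤
      ∫⁻ p, ENNReal.ofReal |p.1 - p.2| ∂(ρ.prod ρ) := by
  have m1 : Measurable (fun p => !₂[p.1, p.1] : ℝ × ℝ → EuclideanSpace ℝ (Fin 2)) :=
    measurable_pair measurable_fst measurable_fst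
  have m2 : Measurable (fun p => !₂[p.1, p.2] : ℝ × ℝ → EuclideanSpace ℝ (Fin 2)) :=
    measurable_pair measurable_fst measurable_snd
  set g : ℝ × ℝ → EuclideanSpace ℝ (Fin 2) × EuclideanSpace ℝ (Fin 2) :=
    fun p => (!₂[p.1, p.1], !₂[p.1, p.2]) with hg
  have mg : Measurable g := m1.prodMk m2
  have md : Measurable (fun b => !₂[b, b] : ℝ → EuclideanSpace ℝ (Fin 2)) :=
    measurable_pair measurable_id measurable_id
  have hc : (ρ.prod ρ).map g ∈ {γ : Measure (EuclideanSpace ℝ (Fin 2) × EuclideanSpace ℝ (Fin 2)) |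
      γ.map Prod.fst = diagonalLaw ρ ∧ γ.map Prod.snd = squareLaw ρ} := by
    refine ⟨?_, ?_⟩
    · rw [Measure.map_map measurable_fst mg, diagonalLaw]
      conv_rhs => rw [← (measurePreserving_fst (μ := ρ) (ν := ρ)).map_eq]
      rw [Measure.map_map md measurable_fst]
      rfl
    · rw [Measure.map_map measurable_snd mg]; rfl
  refine (iInf₂_le _ hc).trans (le_of_eq ?_)
  rw [lintegral_map (by fun_prop) mg]
  refine lintegral_congr fun p => ?_
  rw [edist_eq_sqrt]
  simp [hg, Real.sqrt_sq_eq_abs]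

/-- Under any coupling the first point is almost surely on the diagonal, and `|z₀ - z₁|/√2` is the
distance of `z` from the diagonal. -/
theorem lintegral_le_wasserstein1 (ρ : Measure ℝ) [IsProbabilityMeasure ρ] :
    ∫⁻ p, ENNReal.ofReal (1 / √2 * |p.1 - p.2|) ∂(ρ.prod ρ) ≤
      wasserstein1 (diagonalLaw ρ) (squareLaw ρ) := by
  refine le_iInf₂ fun γ hγ => ?_
  have mc : Measurable fun z : EuclideanSpace ℝ (Fin 2) =>
      ENNReal.ofReal (1 / √2 * |z 0 - z 1|) :=
    (((measurable_coord 0).sub (measurable_coord 1)).abs.const_mul _).ennreal_ofReal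
  have m2 : Measurable (fun p => !₂[p.1, p.2] : ℝ × ℝ → EuclideanSpace ℝ (Fin 2)) :=
    measurable_pair measurable_fst measurable_snd
  have e : ∫⁻ p, ENNReal.ofReal (1 / √2 * |p.1 - p.2|) ∂(ρ.prod ρ) =
      ∫⁻ z, ENNReal.ofReal (1 / √2 * |z.2 0 - z.2 1|) ∂γ := by
    have : ∫⁻ z, ENNReal.ofReal (1 / √2 * |z 0 - z 1|) ∂(γ.map Prod.snd) = _ :=
      lintegral_map mc measurable_snd
    rw [← this, hγ.2, squareLaw, lintegral_map mc m2]
    rfl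
  have hae : ∀ᵐ z ∂γ, z.1 0 = z.1 1 := by
    have hd : ∀ᵐ z ∂(diagonalLaw ρ), z 0 = z 1 := by
      have md : Measurable (fun b => !₂[b, b] : ℝ → EuclideanSpace ℝ (Fin 2)) :=
        measurable_pair measurable_id measurable_id
      rw [diagonalLaw, ae_map_iff md.aemeasurable
        (measurableSet_eq_fun (measurable_coord 0) (measurable_coord 1))]
      exact Eventually.of_forall fun b => rfl
    rw [← hγ.1] at hd
    exact ae_of_ae_map measurable_fst.aemeasurable hd
  rw [e]
  refine lintegral_mono_ae (hae.mono fun z hz => ?_)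
  rw [edist_eq_sqrt]
  refine ENNReal.ofReal_le_ofReal (Real.le_sqrt_of_sq_le ?_)
  rw [mul_pow, div_pow, Real.sq_sqrt (by norm_num), sq_abs, hz]
  -- This is `(u-p)² + (u-q)² = ((p-q)² + (2u-p-q)²)/2`.
  nlinarith [sq_nonneg ((z.1 1 - z.2 0) + (z.1 1 - z.2 1))]

end MeanDifference

/-- A Lipschitz map multiplies the Wasserstein distance by at most its Lipschitz constant. -/
theorem wasserstein1_map_le {X Y : Type*} [PseudoEMetricSpace X] [MeasurableSpace X]
    [OpensMeasurableSpace X] [PseudoEMetricSpace Y] [MeasurableSpace Y] [BorelSpace Y]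
    [SecondCountableTopology Y] {K : ℝ≥0} (hK : K ≠ 0) {F : X → Y} (hF : LipschitzWith K F)
    (μ ν : Measure X) : wasserstein1 (μ.map F) (ν.map F) ≤ K * wasserstein1 μ ν := by
  have hm : Measurable F := hF.continuous.measurable
  have hm2 : Measurable (Prod.map F F) := hm.prodMap hm
  -- A nonzero constant is needed: there may be no couplings, and `0 * ∞ = 0` would break the
  -- passage through an empty infimum.
  rw [wasserstein1, wasserstein1, ENNReal.mul_iInf_of_ne (by simpa using hK) ENNReal.coe_ne_top]
  refine le_iInf fun γ => ?_
  rw [ENNReal.mul_iInf_of_ne (by simpa using hK) ENNReal.coe_ne_top]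
  refine le_iInf fun hγ => ?_
  have hc : γ.map (Prod.map F F) ∈ {γ : Measure (Y × Y) |
      γ.map Prod.fst = μ.map F ∧ γ.map Prod.snd = ν.map F} := by
    refine ⟨?_, ?_⟩
    · rw [Measure.map_map measurable_fst hm2, ← hγ.1, Measure.map_map hm measurable_fst]; rfl
    · rw [Measure.map_map measurable_snd hm2, ← hγ.2, Measure.map_map hm measurable_snd]; rfl
  refine (iInf₂_le _ hc).trans ?_
  rw [lintegral_map measurable_edist hm2, ← lintegral_const_mul' _ _ ENNReal.coe_ne_top]
  exact lintegral_mono fun z => hF z.1 z.2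

/-! ### The path metric -/

namespace PathMetric

open Mismatch

variable {E : Type*} [DecidableEq E]

theorem mismatch_self (i : E) : mismatch (i, i) = 0 := by simp [mismatch]

theorem mismatch_comm (i j : E) : mismatch (i, j) = mismatch (j, i) := by
  simp [mismatch, eq_comm]

theorem mismatch_triangle (i j k : E) : mismatch (i, k) ≤ mismatch (i, j) + mismatch (j, k) := by
  by_cases h1 : i = j
  · subst h1; rw [mismatch_self]; linarith
  · have h2 : mismatch (i, j) = 1 := by simp [mismatch, h1]
    have h3 := mismatch_le_one (i, k)
    have h4 := mismatch_nonneg (j, k)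
    linarith

variable {β η : ℝ}

theorem summable_mismatch (hβ0 : 0 < β) (hβ1 : β < 1) (x y : ℕ → E) :
    Summable fun r : ℕ => β ^ (r + 1) * mismatch (x (r + 1), y (r + 1)) := by
  refine Summable.of_nonneg_of_le (fun r => mul_nonneg (by positivity) (mismatch_nonneg _))
    (fun r => mul_le_of_le_one_right (by positivity) (mismatch_le_one _)) ?_
  exact (summable_nat_add_iff 1).2 (summable_geometric_of_lt_one hβ0.le hβ1)

theorem pathDist_self (x : ℕ → E) : pathDist β η x x = 0 := by
  simp [pathDist, mismatch_self]

theorem pathDist_comm (x y : ℕ → E) : pathDist β η x y = pathDist β η y x := by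
  simp only [pathDist, mismatch_comm (x _) (y _)]

section

variable (hβ0 : 0 < β) (hβ1 : β < 1) (hη : 0 < η)
include hβ0 hβ1 hη

theorem pathDist_triangle (x y z : ℕ → E) :
    pathDist β η x z ≤ pathDist β η x y + pathDist β η y z := by
  have s1 := summable_mismatch hβ0 hβ1 x y
  have s2 := summable_mismatch hβ0 hβ1 y z
  have h : ∑' r : ℕ, β ^ (r + 1) * mismatch (x (r + 1), z (r + 1)) ≤
      ∑' r : ℕ, (β ^ (r + 1) * mismatch (x (r + 1), y (r + 1)) +
        β ^ (r + 1) * mismatch (y (r + 1), z (r + 1))) := by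
    refine (summable_mismatch hβ0 hβ1 x z).tsum_le_tsum (fun r => ?_) (s1.add s2)
    rw [← mul_add]
    exact mul_le_mul_of_nonneg_left (mismatch_triangle _ _ _) (by positivity)
  rw [s1.tsum_add s2] at h
  have h0 := mismatch_triangle (x 0) (y 0) (z 0)
  have h1 := mul_le_mul_of_nonneg_left h hη.le
  simp only [pathDist]
  linarith

omit hβ1 in
theorem mismatch_zero_le_pathDist (x y : ℕ → E) : mismatch (x 0, y 0) ≤ pathDist β η x y :=
  le_add_of_nonneg_right (mul_nonneg hη.le
    (tsum_nonneg fun r => mul_nonneg (by positivity) (mismatch_nonneg _)))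

theorem term_le_pathDist (x y : ℕ → E) (r : ℕ) :
    η * (β ^ (r + 1) * mismatch (x (r + 1), y (r + 1))) ≤ pathDist β η x y := by
  refine le_trans ?_ (le_add_of_nonneg_left (mismatch_nonneg _))
  refine mul_le_mul_of_nonneg_left ?_ hη.le
  exact (summable_mismatch hβ0 hβ1 x y).le_tsum r
    fun k _ => mul_nonneg (by positivity) (mismatch_nonneg _)

theorem min_mul_pow_le_pathDist {x y : ℕ → E} {r : ℕ} (h : x r ≠ y r) :
    min 1 η * β ^ r ≤ pathDist β η x y := by
  have hm : mismatch (x r, y r) = 1 := by simp [mismatch, h]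
  cases r with
  | zero =>
    refine le_trans ?_ (mismatch_zero_le_pathDist hβ0 hη x y)
    rw [hm]; simp
  | succ r =>
    refine le_trans ?_ (term_le_pathDist hβ0 hβ1 hη x y r)
    rw [hm, mul_one]
    exact mul_le_mul_of_nonneg_right (min_le_right _ _) (by positivity)

/-- Only the geometric tail beyond time `n` remains. The case `n = 0` bounds by `τ` the distance
between paths with the same initial letter. -/
theorem pathDist_le_of_agree {x y : ℕ → E} {n : ℕ} (h : ∀ i < n + 1, x i = y i) :
    pathDist β η x y ≤ η * β / (1 - β) * β ^ n := by
  have h0 : mismatch (x 0, y 0) = 0 := by rw [h 0 (by omega), mismatch_self]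
  rw [pathDist, h0, zero_add]
  have hb : ∀ r : ℕ, β ^ (r + 1) * mismatch (x (r + 1), y (r + 1)) ≤
      if n ≤ r then β ^ (r + 1) else 0 := fun r => by
    split_ifs with hr
    · exact mul_le_of_le_one_right (by positivity) (mismatch_le_one _)
    · rw [h (r + 1) (by omega), mismatch_self, mul_zero]
  have hs : HasSum (fun r : ℕ => if n ≤ r then β ^ (r + 1) else 0) (β ^ (n + 1) / (1 - β)) := by
    rw [← hasSum_nat_add_iff' n]
    have e1 : ∑ i ∈ Finset.range n, (if n ≤ i then β ^ (i + 1) else 0) = 0 :=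
      Finset.sum_eq_zero fun i hi => if_neg (by have := Finset.mem_range.1 hi; omega)
    have e2 : (fun r : ℕ => if n ≤ r + n then β ^ (r + n + 1) else 0) =
        fun r => β ^ r * β ^ (n + 1) := by
      funext r; rw [if_pos (by omega)]; ring
    rw [e1, sub_zero, e2, div_eq_inv_mul]
    exact (hasSum_geometric_of_lt_one hβ0.le hβ1).mul_right _
  have hle := (summable_mismatch hβ0 hβ1 x y).tsum_le_tsum hb hs.summable
  rw [hs.tsum_eq] at hle
  calc η * _ ≤ η * (β ^ (n + 1) / (1 - β)) := mul_le_mul_of_nonneg_left hle hη.le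
    _ = _ := by ring

theorem isCompatiblePathMetric : IsCompatiblePathMetric (E := E) (pathDist β η) := by
  let tE : TopologicalSpace E := ⊥
  have dE : DiscreteTopology E := ⟨rfl⟩
  have hmin : 0 < min 1 η := lt_min one_pos hη
  refine ⟨MetricSpace.ofDistTopology (pathDist β η) pathDist_self pathDist_comm
    (pathDist_triangle hβ0 hβ1 hη) (fun s => ⟨fun hs x hx => ?_, fun hs => ?_⟩) (fun x y hxy => ?_),
    fun _ _ => rfl, rfl⟩
  -- Balls of radius `min 1 η * β ^ n` force agreement before time `n`; conversely, long agreement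
  -- makes the distance small. So balls and cylinders generate the same topology.
  · obtain ⟨u, ⟨z, n, rfl⟩, hxu, hus⟩ :=
      (PiNat.isTopologicalBasis_cylinders (fun _ : ℕ => E)).exists_subset_of_mem_open hx hs
    refine ⟨min 1 η * β ^ n, by positivity, fun y hy => hus ?_⟩
    rw [PiNat.mem_cylinder_iff] at hxu ⊢
    intro i hi
    rw [← hxu i hi]
    by_contra hne
    have h1 := min_mul_pow_le_pathDist hβ0 hβ1 hη (Ne.symm hne)
    have h2 : β ^ n ≤ β ^ i := pow_le_pow_of_le_one hβ0.le hβ1.le hi.le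
    have h3 := mul_le_mul_of_nonneg_left h2 hmin.le
    linarith
  · rw [isOpen_iff_mem_nhds]
    intro x hx
    obtain ⟨ε, hε, hsub⟩ := hs x hx
    have hlim : Tendsto (fun n : ℕ => η * β / (1 - β) * β ^ n) atTop (𝓝 0) := by
      simpa using (tendsto_pow_atTop_nhds_zero_of_lt_one hβ0.le hβ1).const_mul (η * β / (1 - β))
    obtain ⟨n, hn⟩ := (hlim.eventually (gt_mem_nhds hε)).exists
    refine Filter.mem_of_superset ((PiNat.isOpen_cylinder (fun _ : ℕ => E) x (n + 1)).mem_nhds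
      (PiNat.self_mem_cylinder x (n + 1))) fun y hy => hsub y ?_
    refine lt_of_le_of_lt (pathDist_le_of_agree hβ0 hβ1 hη fun i hi => ?_) hn
    exact (PiNat.mem_cylinder_iff.1 hy i hi).symm
  · funext r
    by_contra hne
    have h1 := min_mul_pow_le_pathDist hβ0 hβ1 hη hne
    have : 0 < min 1 η * β ^ r := by positivity
    linarith

omit hη in
theorem measurable_pathDist [Countable E] [MeasurableSpace E] [DiscreteMeasurableSpace E] :
    Measurable fun p : (ℕ → E) × (ℕ → E) => pathDist β η p.1 p.2 := by
  have hm : ∀ r : ℕ, Measurable fun p : (ℕ → E) × (ℕ → E) => mismatch (p.1 r, p.2 r) := fun r =>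
    (Measurable.of_discrete (f := (mismatch : E × E → ℝ))).comp (by fun_prop)
  refine (hm 0).add (Measurable.const_mul ?_ η)
  refine measurable_of_tendsto_metrizable (f := fun (n : ℕ) (p : (ℕ → E) × (ℕ → E)) =>
    ∑ r ∈ Finset.range n, β ^ (r + 1) * mismatch (p.1 (r + 1), p.2 (r + 1)))
    (fun n => Finset.measurable_fun_sum _ fun r _ => (hm (r + 1)).const_mul _) ?_
  rw [tendsto_pi_nhds]
  exact fun p => (summable_mismatch hβ0 hβ1 p.1 p.2).hasSum.tendsto_sum_nat

end

/-! ### The Lipschitz projection of the distance arrays -/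

/-- The piecewise linear function equal to `0` on `(-∞, τ]` and to `1` on `[1, ∞)`. -/
noncomputable def ramp (τ s : ℝ) : ℝ := max 0 (min 1 ((s - τ) / (1 - τ)))

theorem abs_ramp_sub_le {τ : ℝ} (hτ : τ < 1) (s t : ℝ) :
    |ramp τ s - ramp τ t| ≤ 1 / (1 - τ) * |s - t| := by
  have h : 0 < 1 - τ := by linarith
  have e : (s - τ) / (1 - τ) - (t - τ) / (1 - τ) = 1 / (1 - τ) * (s - t) := by field_simp; ring
  calc |ramp τ s - ramp τ t| ≤ |min 1 ((s - τ) / (1 - τ)) - min 1 ((t - τ) / (1 - τ))| := by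
        have := abs_max_sub_max_le_max 0 (min 1 ((s - τ) / (1 - τ))) 0 (min 1 ((t - τ) / (1 - τ)))
        simpa [ramp] using this
    _ ≤ |(s - τ) / (1 - τ) - (t - τ) / (1 - τ)| := by
        have := abs_min_sub_min_le_max 1 ((s - τ) / (1 - τ)) 1 ((t - τ) / (1 - τ))
        simpa using this
    _ = _ := by rw [e, abs_mul, abs_of_pos (by positivity)]

/-- No path distance lies strictly between `τ` and `1`, and which side it falls on decides whether
the initial letters agree. -/
theorem ramp_pathDist {τ : ℝ} (hβ0 : 0 < β) (hβ1 : β < 1) (hη : 0 < η)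
    (hτ : τ = η * β / (1 - β)) (hτ1 : τ < 1) (x y : ℕ → E) :
    ramp τ (pathDist β η x y) = mismatch (x 0, y 0) := by
  have h : 0 < 1 - τ := by linarith
  by_cases hxy : x 0 = y 0
  · have h1 : pathDist β η x y ≤ τ := by
      have := pathDist_le_of_agree hβ0 hβ1 hη (x := x) (y := y) (n := 0)
        (fun i hi => by rw [Nat.lt_one_iff.1 hi, hxy])
      rwa [pow_zero, mul_one, ← hτ] at this
    rw [hxy, mismatch_self, ramp]
    refine max_eq_left ((min_le_right _ _).trans ?_)
    exact div_nonpos_of_nonpos_of_nonneg (by linarith) h.le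
  · have hm : mismatch (x 0, y 0) = 1 := by simp [mismatch, hxy]
    have h1 := mismatch_zero_le_pathDist hβ0 hη x y
    rw [hm] at h1 ⊢
    rw [ramp, min_eq_left, max_eq_right zero_le_one]
    rw [le_div_iff₀ h]; linarith

/-- The average of the ramp over the simultaneous distances of the two particles, in each of the
two matrices of the array. -/
noncomputable def arrayProjection (τ : ℝ) (m : ℕ) (A : ArraySpace 2 m) :
    EuclideanSpace ℝ (Fin 2) :=
  !₂[1 / (m : ℝ) * ∑ t : Fin m, ramp τ (A (Sum.inl ((0, t), (1, t)))),
    1 / (m : ℝ) * ∑ t : Fin m, ramp τ (A (Sum.inr ((0, t), (1, t))))]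

/-- Cauchy–Schwarz over `m` terms leaves `1/m` in the squared bound, the source of the `1/√m` in the
Lipschitz constant. -/
theorem sq_average_sub_le {τ : ℝ} (hτ : τ < 1) {m : ℕ} (hm : m ≠ 0) (a b : Fin m → ℝ) :
    (1 / (m : ℝ) * ∑ t, ramp τ (a t) - 1 / (m : ℝ) * ∑ t, ramp τ (b t)) ^ 2 ≤
      (1 / (1 - τ)) ^ 2 / m * ∑ t, (a t - b t) ^ 2 := by
  have hm0 : (0 : ℝ) < m := Nat.cast_pos.2 (Nat.pos_of_ne_zero hm)
  rw [← mul_sub, ← Finset.sum_sub_distrib, mul_pow]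
  have h1 : (∑ t : Fin m, (ramp τ (a t) - ramp τ (b t))) ^ 2 ≤
      m * ∑ t : Fin m, (ramp τ (a t) - ramp τ (b t)) ^ 2 := by
    simpa using sq_sum_le_card_mul_sum_sq (s := Finset.univ)
      (f := fun t : Fin m => ramp τ (a t) - ramp τ (b t))
  have h2 : ∑ t : Fin m, (ramp τ (a t) - ramp τ (b t)) ^ 2 ≤
      (1 / (1 - τ)) ^ 2 * ∑ t, (a t - b t) ^ 2 := by
    rw [Finset.mul_sum]
    refine Finset.sum_le_sum fun t _ => ?_
    rw [← sq_abs, ← sq_abs (a t - b t), ← mul_pow]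
    exact pow_le_pow_left₀ (abs_nonneg _) (abs_ramp_sub_le hτ _ _) 2
  calc _ ≤ (1 / (m : ℝ)) ^ 2 * (m * ((1 / (1 - τ)) ^ 2 * ∑ t, (a t - b t) ^ 2)) := by
        gcongr; exact h1.trans (by gcongr)
    _ = _ := by field_simp

theorem sum_simultaneous_le {m : ℕ} (g : ArrayIndex 2 m → ℝ) (hg : ∀ p, 0 ≤ g p) :
    ∑ t : Fin m, g ((0, t), (1, t)) ≤ ∑ p, g p := by
  have hinj : Function.Injective fun t : Fin m => (((0, t), (1, t)) : ArrayIndex 2 m) :=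
    fun s t h => congrArg (fun p : ArrayIndex 2 m => p.1.2) h
  have := Finset.sum_map Finset.univ ⟨_, hinj⟩ g
  simp only [Function.Embedding.coeFn_mk] at this
  rw [← this]
  exact Finset.sum_le_univ_sum_of_nonneg hg

theorem lipschitzWith_arrayProjection {τ : ℝ} (hτ : τ < 1) {m : ℕ} (hm : m ≠ 0) :
    LipschitzWith (Real.toNNReal (1 / ((1 - τ) * √m))) (arrayProjection τ m) := by
  have hm0 : (0 : ℝ) < m := Nat.cast_pos.2 (Nat.pos_of_ne_zero hm)
  have h : 0 < 1 - τ := by linarith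
  refine LipschitzWith.of_dist_le_mul fun A B => ?_
  rw [Real.coe_toNNReal _ (by positivity)]
  rw [EuclideanSpace.dist_eq, EuclideanSpace.dist_eq]
  refine Real.sqrt_le_iff.2 ⟨by positivity, ?_⟩
  rw [mul_pow, Real.sq_sqrt (by positivity), Fin.sum_univ_two, Fintype.sum_sum_type]
  simp only [Real.dist_eq, sq_abs]
  have h1 := sq_average_sub_le hτ hm (fun t => A (Sum.inl ((0, t), (1, t))))
    (fun t => B (Sum.inl ((0, t), (1, t))))
  have h2 := sq_average_sub_le hτ hm (fun t => A (Sum.inr ((0, t), (1, t))))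
    (fun t => B (Sum.inr ((0, t), (1, t))))
  have h3 := sum_simultaneous_le (fun p : ArrayIndex 2 m => (A (Sum.inl p) - B (Sum.inl p)) ^ 2)
    (fun p => sq_nonneg _)
  have h4 := sum_simultaneous_le (fun p : ArrayIndex 2 m => (A (Sum.inr p) - B (Sum.inr p)) ^ 2)
    (fun p => sq_nonneg _)
  have e : (1 / ((1 - τ) * √(m : ℝ))) ^ 2 = (1 / (1 - τ)) ^ 2 / m := by
    rw [div_pow, mul_pow, Real.sq_sqrt hm0.le]; field_simp
  rw [e, mul_add]
  have hc : 0 ≤ (1 / (1 - τ)) ^ 2 / (m : ℝ) := by positivity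
  exact add_le_add (h1.trans (mul_le_mul_of_nonneg_left h3 hc))
    (h2.trans (mul_le_mul_of_nonneg_left h4 hc))

theorem arrayProjection_distanceArray {τ : ℝ} (hβ0 : 0 < β) (hβ1 : β < 1) (hη : 0 < η)
    (hτ : τ = η * β / (1 - β)) (hτ1 : τ < 1) (m : ℕ) (z : Fin 2 → (ℕ → E) × (ℕ → E)) :
    arrayProjection τ m
        (distanceArray (pathDist β η) leftShift (pathDist β η) leftShift 2 m z) =
      !₂[mismatchAverage m (z 0).1 (z 1).1, mismatchAverage m (z 0).2 (z 1).2] := by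
  have hl : ∀ (x : ℕ → E) (s : ℕ), leftShift^[s] x 0 = x s := by
    intro x s
    rw [MarkovMeasure.leftShift_iterate_apply, zero_add]
  simp only [arrayProjection, distanceArray, mismatchAverage, Sum.elim_inl, Sum.elim_inr,
    ramp_pathDist hβ0 hβ1 hη hτ hτ1, hl, Finset.sum_range]

variable [Countable E] [MeasurableSpace E] [DiscreteMeasurableSpace E]

theorem measurable_distanceArray (hβ0 : 0 < β) (hβ1 : β < 1) (m : ℕ) :
    Measurable (distanceArray (pathDist (E := E) β η) leftShift (pathDist (E := E) β η) leftShift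
      2 m) := by
  have hs : ∀ s : ℕ, Measurable ((leftShift (E := E))^[s]) := fun s =>
    MarkovMeasure.measurable_leftShift.iterate s
  refine (WithLp.measurable_toLp 2 _).comp (measurable_pi_lambda _ fun i => ?_)
  have hd := measurable_pathDist (E := E) (η := η) hβ0 hβ1
  rcases i with p | p
  · exact hd.comp (((hs _).comp (measurable_fst.comp (measurable_pi_apply _))).prodMk
      ((hs _).comp (measurable_fst.comp (measurable_pi_apply _))))
  · exact hd.comp (((hs _).comp (measurable_snd.comp (measurable_pi_apply _))).prodMk
      ((hs _).comp (measurable_snd.comp (measurable_pi_apply _))))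

theorem map_arrayProjection {τ : ℝ} (hβ0 : 0 < β) (hβ1 : β < 1) (hη : 0 < η)
    (hτ : τ = η * β / (1 - β)) (hτ1 : τ < 1) {m : ℕ} (hm : m ≠ 0)
    (l : Measure ((ℕ → E) × (ℕ → E))) :
    (arrayLaw (pathDist β η) leftShift (pathDist β η) leftShift 2 m l).map (arrayProjection τ m) =
      mismatchLaw m l := by
  rw [arrayLaw, Measure.map_map (lipschitzWith_arrayProjection hτ1 hm).continuous.measurable
    (measurable_distanceArray hβ0 hβ1 m), mismatchLaw]
  congr 1
  funext z
  exact arrayProjection_distanceArray hβ0 hβ1 hη hτ hτ1 m z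

end PathMetric

/-! ### The two mismatch laws -/

namespace Mismatch

open MeanDifference

/-- Regroups two independent particles `(xᵢ, yᵢ)` into the pairs of `x`'s and of `y`'s; under the
product joining these pairs are independent, hence so are the two mismatch averages. -/
theorem measurePreserving_prodProdProdComm {X Y : Type*} [MeasurableSpace X] [MeasurableSpace Y]
    (μ : Measure X) (ν : Measure Y) [IsProbabilityMeasure μ] [IsProbabilityMeasure ν] :
    MeasurePreserving (fun q : (X × Y) × (X × Y) => ((q.1.1, q.2.1), (q.1.2, q.2.2)))
      ((μ.prod ν).prod (μ.prod ν)) ((μ.prod μ).prod (ν.prod ν)) := by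
  have h1 := measurePreserving_prodAssoc μ ν (μ.prod ν)
  have h2 := (MeasurePreserving.id μ).prod ((measurePreserving_prodAssoc ν μ ν).symm)
  have h3 := (MeasurePreserving.id μ).prod
    ((Measure.measurePreserving_swap (μ := ν) (ν := μ)).prod (MeasurePreserving.id ν))
  have h4 := (MeasurePreserving.id μ).prod (measurePreserving_prodAssoc μ ν ν)
  have h5 := (measurePreserving_prodAssoc μ μ (ν.prod ν)).symm
  exact h5.comp (h4.comp (h3.comp (h2.comp h1)))

variable {E : Type*} [DecidableEq E] [Fintype E] [MeasurableSpace E] [DiscreteMeasurableSpace E]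

theorem mismatchLaw_eq (m : ℕ) (l : Measure ((ℕ → E) × (ℕ → E))) [IsProbabilityMeasure l] :
    mismatchLaw m l = (l.prod l).map fun q =>
      !₂[mismatchAverage m q.1.1 q.2.1, mismatchAverage m q.1.2 q.2.2] := by
  have hB := measurable_mismatchAverage (E := E) m
  have hm : Measurable (fun q => !₂[mismatchAverage m q.1.1 q.2.1, mismatchAverage m q.1.2 q.2.2] :
      ((ℕ → E) × (ℕ → E)) × ((ℕ → E) × (ℕ → E)) → EuclideanSpace ℝ (Fin 2)) :=
    measurable_pair
      (hB.comp ((measurable_fst.comp measurable_fst).prodMk (measurable_fst.comp measurable_snd)))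
      (hB.comp ((measurable_snd.comp measurable_fst).prodMk (measurable_snd.comp measurable_snd)))
  rw [← (measurePreserving_finTwoArrow l).map_eq,
    Measure.map_map hm MeasurableEquiv.finTwoArrow.measurable]
  rfl

theorem mismatchLaw_diagJoining (μ : Measure (ℕ → E)) [IsProbabilityMeasure μ] (m : ℕ) :
    mismatchLaw m (diagJoining μ) = diagonalLaw (averageLaw μ m) := by
  have hd : Measurable fun x : ℕ → E => (x, x) := measurable_id.prodMk measurable_id
  have hB := measurable_mismatchAverage (E := E) m
  have : IsProbabilityMeasure (diagJoining μ) := Measure.isProbabilityMeasure_map hd.aemeasurable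
  have hm : Measurable (fun q => !₂[mismatchAverage m q.1.1 q.2.1, mismatchAverage m q.1.2 q.2.2] :
      ((ℕ → E) × (ℕ → E)) × ((ℕ → E) × (ℕ → E)) → EuclideanSpace ℝ (Fin 2)) :=
    measurable_pair
      (hB.comp ((measurable_fst.comp measurable_fst).prodMk (measurable_fst.comp measurable_snd)))
      (hB.comp ((measurable_snd.comp measurable_fst).prodMk (measurable_snd.comp measurable_snd)))
  have md : Measurable (fun b => !₂[b, b] : ℝ → EuclideanSpace ℝ (Fin 2)) :=
    measurable_pair measurable_id measurable_id
  rw [mismatchLaw_eq, diagJoining, Measure.map_prod_map _ _ hd hd,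
    Measure.map_map hm (hd.prodMap hd), diagonalLaw, averageLaw, Measure.map_map md hB]
  rfl

theorem mismatchLaw_prod (μ : Measure (ℕ → E)) [IsProbabilityMeasure μ] (m : ℕ) :
    mismatchLaw m (μ.prod μ) = squareLaw (averageLaw μ m) := by
  have hB := measurable_mismatchAverage (E := E) m
  have m2 : Measurable (fun p => !₂[p.1, p.2] : ℝ × ℝ → EuclideanSpace ℝ (Fin 2)) :=
    measurable_pair measurable_fst measurable_snd
  rw [mismatchLaw_eq, squareLaw, averageLaw, Measure.map_prod_map _ _ hB hB]
  conv_rhs => rw [← (measurePreserving_prodProdProdComm μ μ).map_eq, Measure.map_map (hB.prodMap hB)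
      (measurePreserving_prodProdProdComm μ μ).measurable,
    Measure.map_map m2 ((hB.prodMap hB).comp (measurePreserving_prodProdProdComm μ μ).measurable)]
  rfl

theorem memLp_averageLaw (μ : Measure (ℕ → E)) [IsProbabilityMeasure μ] (m : ℕ) :
    MemLp id 2 (averageLaw μ m) := by
  have hB := measurable_mismatchAverage (E := E) m
  refine MemLp.of_bound (by fun_prop) 1 ?_
  rw [averageLaw, ae_map_iff hB.aemeasurable (measurableSet_le (by fun_prop) (by fun_prop))]
  refine Eventually.of_forall fun p => ?_
  have h0 : 0 ≤ mismatchAverage m p.1 p.2 :=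
    mul_nonneg (by positivity) (Finset.sum_nonneg fun t _ => mismatch_nonneg _)
  rw [id, Real.norm_of_nonneg h0, mismatchAverage]
  have h1 : ∑ t ∈ Finset.range m, mismatch (p.1 t, p.2 t) ≤ m := by
    simpa using Finset.sum_le_sum fun (t : ℕ) (_ : t ∈ Finset.range m) =>
      mismatch_le_one (p.1 t, p.2 t)
  rw [one_div_mul_eq_div]
  exact div_le_one_of_le₀ h1 (Nat.cast_nonneg m)

end Mismatch

theorem isJoining_diagJoining {X : Type*} [MeasurableSpace X] {μ : Measure X} {T : X → X}
    (hT : MeasurePreserving T μ μ) : IsJoining μ T μ T (diagJoining μ) := by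
  have hd : Measurable fun x : X => (x, x) := measurable_id.prodMk measurable_id
  refine ⟨?_, ?_, ?_⟩
  · rw [diagJoining, Measure.map_map measurable_fst hd]; exact Measure.map_id
  · rw [diagJoining, Measure.map_map measurable_snd hd]; exact Measure.map_id
  · rw [diagJoining, Measure.map_map (hT.measurable.prodMap hT.measurable) hd]
    conv_rhs => rw [← hT.map_eq, Measure.map_map hd hT.measurable]
    rfl

/-! ### Bounds for the distance between the two mismatch laws -/

namespace Mismatch

open MeanDifference

variable {E : Type*} [Fintype E] [DecidableEq E] [MeasurableSpace E] [DiscreteMeasurableSpace E]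
  {P : Matrix.rowStochastic ℝ E} {π : stdSimplex ℝ E} {θ : ℝ}

theorem wasserstein1_mismatchLaw_le (hK : HasSpectralGap P.1 π.1 θ) {m : ℕ} (hm : m ≠ 0) :
    wasserstein1 (mismatchLaw m (diagJoining (markovMeasure P π)))
        (mismatchLaw m ((markovMeasure P π).prod (markovMeasure P π))) ≤
      ENNReal.ofReal √(2 * mismatchVariance π * (1 + θ) / (m * (1 - θ))) := by
  rw [mismatchLaw_diagJoining, mismatchLaw_prod]
  refine (wasserstein1_le _).trans ((lintegral_abs_sub_le (memLp_averageLaw _ m) _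
    (integral_sq_averageLaw_le hK hm)).trans (le_of_eq ?_))
  congr 2; ring

/-- The factor `c` is `1` for the mismatch laws and `1 - τ` for the array laws. -/
theorem lintegral_le_wasserstein1_mismatchLaw (μ : Measure (ℕ → E)) [IsProbabilityMeasure μ]
    (m : ℕ) {c : ℝ} (hc : 0 ≤ c) :
    ∫⁻ p, ENNReal.ofReal (c / √2 * (√m * |p.1 - p.2|))
        ∂((averageLaw μ m).prod (averageLaw μ m)) ≤
      ENNReal.ofReal (c * √m) *
        wasserstein1 (mismatchLaw m (diagJoining μ)) (mismatchLaw m (μ.prod μ)) := by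
  rw [mismatchLaw_diagJoining, mismatchLaw_prod]
  refine le_trans (le_of_eq ?_) (mul_le_mul_right (lintegral_le_wasserstein1 _) _)
  rw [← lintegral_const_mul' _ _ ENNReal.ofReal_ne_top]
  refine lintegral_congr fun p => ?_
  rw [← ENNReal.ofReal_mul (by positivity)]
  congr 1; ring

theorem le_liminf_lintegral_averageLaw [Nontrivial E] (hK : HasSpectralGap P.1 π.1 θ) {c : ℝ}
    (hc : 0 ≤ c) :
    ENNReal.ofReal (c * (2 * √(mismatchSigmaSq P π) / √Real.pi)) ≤ liminf (fun m : ℕ =>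
      ∫⁻ p, ENNReal.ofReal (c * (√m * |p.1 - p.2|))
        ∂((averageLaw (markovMeasure P π) m).prod (averageLaw (markovMeasure P π) m))) atTop :=
  le_liminf_lintegral (mismatchSigmaSq_pos hK) (tendsto_integral_exp hK) hc

end Mismatch

theorem mainTheorem10 {E : Type*} [Fintype E] [DecidableEq E] [Nontrivial E]
    [MeasurableSpace E] [DiscreteMeasurableSpace E]
    (P : Matrix.rowStochastic ℝ E) (π : stdSimplex ℝ E)
    (hirr : P.1.IsIrreducible) (haper : IsAperiodic P.1)
    (hstat : IsStationaryLaw P.1 π.1) (hrev : IsReversibleFor P.1 π.1)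
    (β η τ : ℝ) (hβ0 : 0 < β) (hβ1 : β < 1) (hη : 0 < η)
    (hτ : τ = η * β / (1 - β)) (hτ1 : τ < 1)
    (θ : ℝ) (hθ : θ = spectralTheta P.1)
    (v : ℝ) (hv : v = mismatchVariance π)
    (σ : ℝ) (hσ : σ = Real.sqrt (mismatchSigmaSq P π))
    (μ : Measure (ℕ → E)) (hμ : μ = markovMeasure P π)
    (QD QP : ℕ → Measure (EuclideanSpace ℝ (Fin 2)))
    (hQD : ∀ m, QD m = mismatchLaw m (diagJoining μ))
    (hQP : ∀ m, QP m = mismatchLaw m (μ.prod μ))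
    (FD FP : (m : ℕ) → Measure (ArraySpace 2 m))
    (hFD : ∀ m, FD m =
      arrayLaw (pathDist β η) leftShift (pathDist β η) leftShift 2 m (diagJoining μ))
    (hFP : ∀ m, FP m =
      arrayLaw (pathDist β η) leftShift (pathDist β η) leftShift 2 m (μ.prod μ)) :
    -- the objects are what they are meant to be
    IsCompatiblePathMetric (E := E) (pathDist β η) ∧
    (IsProbabilityMeasure μ ∧ MeasurePreserving leftShift μ μ) ∧
    IsJoining μ leftShift μ leftShift (diagJoining μ) ∧
    (IsGreatest (nontrivialSpectralModuli P.1) θ ∧ θ < 1) ∧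
    -- the asymptotic variance
    Summable (fun t : ℕ => mismatchCov P π (t + 1)) ∧
    0 < mismatchSigmaSq P π ∧
    -- the upper bound
    (∀ m : ℕ, 1 ≤ m → wasserstein1 (QD m) (QP m) ≤
      ENNReal.ofReal (Real.sqrt (2 * v * (1 + θ) / (m * (1 - θ))))) ∧
    -- the lower bounds
    ENNReal.ofReal (Real.sqrt 2 * σ / Real.sqrt Real.pi) ≤
      liminf (fun m : ℕ => ENNReal.ofReal (Real.sqrt m) * wasserstein1 (QD m) (QP m)) atTop ∧
    (∀ᶠ m : ℕ in atTop,
      ENNReal.ofReal (σ / Real.sqrt (2 * Real.pi * m)) ≤ wasserstein1 (QD m) (QP m)) ∧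
    -- the sharp order
    (fun m : ℕ => (wasserstein1 (QD m) (QP m)).toReal) =Θ[atTop]
      (fun m : ℕ => (Real.sqrt m)⁻¹) ∧
    -- the Lipschitz projection of the full array laws
    (∀ m : ℕ, 1 ≤ m → ∃ F : ArraySpace 2 m → EuclideanSpace ℝ (Fin 2),
      LipschitzWith (Real.toNNReal (1 / ((1 - τ) * Real.sqrt m))) F ∧
      (FD m).map F = QD m ∧ (FP m).map F = QP m) ∧
    (∀ m : ℕ, 1 ≤ m → wasserstein1 (QD m) (QP m) ≤
      ENNReal.ofReal (1 / ((1 - τ) * Real.sqrt m)) * wasserstein1 (FD m) (FP m)) ∧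
    -- the separation of the full array laws
    ENNReal.ofReal (Real.sqrt 2 * (1 - τ) * σ / Real.sqrt Real.pi) ≤
      liminf (fun m : ℕ => wasserstein1 (FD m) (FP m)) atTop := by
  subst hτ hθ hv hσ hμ
  obtain rfl : QD = fun m => mismatchLaw m (diagJoining (markovMeasure P π)) := funext hQD
  obtain rfl : QP = fun m => mismatchLaw m ((markovMeasure P π).prod (markovMeasure P π)) :=
    funext hQP
  set τ := η * β / (1 - β) with hτ
  set σ := √(mismatchSigmaSq P π) with hσ
  set W : ℕ → ℝ≥0∞ := fun m => wasserstein1 (mismatchLaw m (diagJoining (markovMeasure P π)))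
    (mismatchLaw m ((markovMeasure P π).prod (markovMeasure P π))) with hW
  have hpos := ReversibleChain.stationary_pos hirr π.2.1 π.2.2 hstat
  have hK := ReversibleChain.hasSpectralGap hpos hrev π.2.2 hirr haper hstat
  have hmp := MarkovMeasure.measurePreserving_leftShift hstat
  have hs := Mismatch.mismatchSigmaSq_pos hK
  have hσ0 : 0 < σ := Real.sqrt_pos.2 hs
  have hτ0 : 0 < 1 - τ := by linarith
  have hpi := Real.pi_pos
  have hup : ∀ m : ℕ, 1 ≤ m → W m ≤ ENNReal.ofReal
      √(2 * mismatchVariance π * (1 + spectralTheta P.1) / (m * (1 - spectralTheta P.1))) :=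
    fun m hm => Mismatch.wasserstein1_mismatchLaw_le hK (by omega)
  have hlow : ENNReal.ofReal (√2 * σ / √Real.pi) ≤
      liminf (fun m : ℕ => ENNReal.ofReal √m * W m) atTop := by
    have h := Mismatch.le_liminf_lintegral_averageLaw hK (c := 1 / √2) (by positivity)
    have e : 1 / √2 * (2 * σ / √Real.pi) = √2 * σ / √Real.pi := by
      have := Real.mul_self_sqrt (show (0 : ℝ) ≤ 2 by norm_num)
      field_simp; linarith
    rw [e] at h
    refine h.trans (liminf_le_liminf (Eventually.of_forall fun m => ?_))
    have := Mismatch.lintegral_le_wasserstein1_mismatchLaw (markovMeasure P π) m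
      (c := 1) zero_le_one
    rwa [one_mul] at this
  have hev : ∀ᶠ m : ℕ in atTop, ENNReal.ofReal (σ / √(2 * Real.pi * m)) ≤ W m := by
    -- The target constant is half of the liminf bound; this slack makes the estimate hold
    -- eventually.
    have hlt : ENNReal.ofReal (σ / √(2 * Real.pi)) < ENNReal.ofReal (√2 * σ / √Real.pi) := by
      rw [ENNReal.ofReal_lt_ofReal_iff (by positivity), Real.sqrt_mul (by norm_num)]
      rw [div_lt_div_iff₀ (by positivity) (by positivity)]
      have := Real.mul_self_sqrt (show (0 : ℝ) ≤ 2 by norm_num)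
      have h1 : 0 < σ * √Real.pi := by positivity
      calc σ * √Real.pi < 2 * (σ * √Real.pi) := by linarith
        _ = (√2 * √2) * (σ * √Real.pi) := by rw [this]
        _ = _ := by ring
    filter_upwards [eventually_lt_of_lt_liminf (hlt.trans_le hlow), eventually_gt_atTop 0]
      with m hm hm0
    have hm0' : (0 : ℝ) < m := Nat.cast_pos.2 hm0
    have hsm : 0 < √(m : ℝ) := Real.sqrt_pos.2 hm0'
    have e : ENNReal.ofReal (σ / √(2 * Real.pi)) =
        ENNReal.ofReal √m * ENNReal.ofReal (σ / √(2 * Real.pi * m)) := by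
      rw [← ENNReal.ofReal_mul hsm.le, Real.sqrt_mul (by positivity) (m : ℝ)]
      congr 1; field_simp
    rw [e] at hm
    exact (ENNReal.mul_le_mul_iff_right (by simpa using hm0) ENNReal.ofReal_ne_top).1 hm.le
  have hproj : ∀ m : ℕ, 1 ≤ m → W m ≤ ENNReal.ofReal (1 / ((1 - τ) * √m)) *
      wasserstein1 (FD m) (FP m) := fun m hm => by
    have hm0 : (0 : ℝ) < m := Nat.cast_pos.2 hm
    have hmap := PathMetric.map_arrayProjection (E := E) hβ0 hβ1 hη hτ hτ1 (m := m) (by omega)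
    simp only [hW]
    rw [← hmap, ← hmap, hFD, hFP]
    refine wasserstein1_map_le ?_ (PathMetric.lipschitzWith_arrayProjection hτ1 (by omega)) _ _
    exact (Real.toNNReal_pos.2 (by positivity)).ne'
  refine ⟨PathMetric.isCompatiblePathMetric hβ0 hβ1 hη, ⟨inferInstance, hmp⟩,
    isJoining_diagJoining hmp,
    ⟨ReversibleChain.isGreatest_spectralTheta hpos hrev π.2.2 hirr, hK.theta_lt_one⟩,
    Mismatch.summable_mismatchCov hK, hs, hup, hlow, hev, ⟨?_, ?_⟩,
    fun m hm => ⟨PathMetric.arrayProjection τ m,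
      PathMetric.lipschitzWith_arrayProjection hτ1 (by omega), ?_, ?_⟩, hproj, ?_⟩
  · refine Asymptotics.IsBigO.of_bound
      √(2 * mismatchVariance π * (1 + spectralTheta P.1) / (1 - spectralTheta P.1)) ?_
    filter_upwards [eventually_ge_atTop 1] with m hm
    have h := ENNReal.toReal_mono ENNReal.ofReal_ne_top (hup m hm)
    rw [ENNReal.toReal_ofReal (Real.sqrt_nonneg _)] at h
    rw [Real.norm_of_nonneg ENNReal.toReal_nonneg, Real.norm_of_nonneg (by positivity)]
    refine h.trans (le_of_eq ?_)
    rw [← Real.sqrt_inv, ← Real.sqrt_mul' _ (by positivity)]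
    congr 1
    rw [← div_eq_mul_inv, div_div, mul_comm (m : ℝ)]
  · refine Asymptotics.IsBigO.of_bound (√(2 * Real.pi) / σ) ?_
    filter_upwards [eventually_ge_atTop 1, hev] with m hm hl
    -- Finiteness comes from the upper bound and is essential here, because `toReal` sends `∞` to
    -- `0`.
    have hne : W m ≠ ∞ := ((hup m hm).trans_lt ENNReal.ofReal_lt_top).ne
    have h := ENNReal.toReal_mono hne hl
    rw [ENNReal.toReal_ofReal (by positivity)] at h
    rw [Real.norm_of_nonneg (by positivity), Real.norm_of_nonneg ENNReal.toReal_nonneg]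
    have hm0 : (0 : ℝ) < m := Nat.cast_pos.2 hm
    have hsm : 0 < √(m : ℝ) := Real.sqrt_pos.2 hm0
    calc (√(m : ℝ))⁻¹ = √(2 * Real.pi) / σ * (σ / √(2 * Real.pi * m)) := by
          rw [Real.sqrt_mul (by positivity) (m : ℝ)]; field_simp
      _ ≤ _ := mul_le_mul_of_nonneg_left h (by positivity)
  · rw [hFD]; exact PathMetric.map_arrayProjection hβ0 hβ1 hη hτ hτ1 (by omega) _
  · rw [hFP]; exact PathMetric.map_arrayProjection hβ0 hβ1 hη hτ hτ1 (by omega) _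
  · have h := Mismatch.le_liminf_lintegral_averageLaw hK (c := (1 - τ) / √2) (by positivity)
    have e : (1 - τ) / √2 * (2 * σ / √Real.pi) = √2 * (1 - τ) * σ / √Real.pi := by
      have := Real.mul_self_sqrt (show (0 : ℝ) ≤ 2 by norm_num)
      field_simp; linarith
    rw [e] at h
    refine h.trans (liminf_le_liminf ?_)
    filter_upwards [eventually_ge_atTop 1] with m hm
    have hm0 : (0 : ℝ) < m := Nat.cast_pos.2 hm
    have hsm : 0 < √(m : ℝ) := Real.sqrt_pos.2 hm0
    refine (Mismatch.lintegral_le_wasserstein1_mismatchLaw (markovMeasure P π) m hτ0.le).trans ?_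
    -- The factor `(1 - τ)√m` is the reciprocal of the Lipschitz constant, so no power of `m`
    -- survives.
    refine (mul_le_mul_right (hproj m hm) _).trans (le_of_eq ?_)
    rw [← mul_assoc, ← ENNReal.ofReal_mul (by positivity), mul_one_div_cancel (by positivity),
      ENNReal.ofReal_one, one_mul]
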